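/- Fix $r_{\min}>0$. An oriented point $P=(\mathbf p,\theta)$ is a point $\mathbf p\in\mathbb R^2$ with a heading angle $\theta$. A (curvature-bounded) trajectory of length $l\ge 0$ from $A=(\mathbf a,\alpha)$ to $B=(\mathbf b,\beta)$ is a $C^1$, piecewise $C^2$ map $\Lambda:[0,l]\to\mathbb R^2$ with $|\Lambda'|=1$, $\Lambda(0)=\mathbf a$, $\Lambda(l)=\mathbf b$, $\Lambda'(0)=(\cos\alpha,\sin\alpha)$, $\Lambda'(l)=(\cos\beta,\sin\beta)$, and $\|\Lambda''\|\le 1/r_{\min}$ wherever $\Lambda''$ is defined (for $l=0$ this is the constant path, which requires $\mathbf a=\mathbf b$ and equal directions). A Dubins shortest path from $A$ to $B$ is a trajectory of minimal length among all of these; its length is denoted $l_m$. It is of the form $C_\eta S_d C_\zeta$ if it consists of an arc of length $\eta$ of a circle of radius $r_{\min}$, a straight segment of length $d$, and an arc of length $\zeta$ of a circle of radius $r_{\min}$ (with either turning direction on each arc; pieces may have length zero). Let $\mathbf c^r_P$ and $\mathbf c^l_P$ be the centres of the circles of radius $r_{\min}$ through $\mathbf p$ tangent to the heading of $P$ and corresponding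 to a right, respectively left, turn. Let $\mathcal O$ be the set of pairs $(A,B)$ that have a Dubins shortest path of the form $C_\eta S_dC_\zeta$ such that at least one of the following holds: $\eta\ge\pi r_{\min}$; $\zeta\ge\pi r_{\min}$; $d\ge 4r_{\min}$; $|\mathbf c^r_A-\mathbf c^r_B|\ge 4r_{\min}$; $|\mathbf c^l_A-\mathbf c^l_B|\ge 4r_{\min}$. For signed radii (positive: counter-clockwise motion, negative: clockwise motion), a $\mathbf C^{r_1}\mathbf C^{r_2}\mathbf C^{r_3}$ trajectory is one that is the union of three consecutive arcs, each less than a full turn and possibly reduced to a point, of circles of signed radii $r_1,r_2,r_3$, where consecutive circles are distinct and tangent at the changeover point and run in agreeing directions there. Here $r_1,r_3$ are finite, and $r_2=\pm\infty$, i.e. a straight segment as the middle piece, is allowed. **Theorem.** If $(A,B)\in\mathcal O$, then for every $l_o\in[l_m,\infty)$ there is a curvature-bounded $\mathbf C^{r_1}\mathbf C^{r_2}\mathbf C^{r_3}$ trajectory from $A$ to $B$ of length $l_o$, with $|r_1|,|r_2|,|r_3|\ge r_{\min}$. -/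

import Mathlib

open Set

noncomputable section

/-- An oriented point of the plane (the plane `ℝ²` is modelled by `ℂ`, whose norm is the Euclidean
one): a position together with a heading angle, measured from the positive real axis. -/
structure OrientedPoint where
  pos : ℂ
  angle : ℝ

/-- The unit vector `(cos θ, sin θ)`. -/
def unitVec (θ : ℝ) : ℂ := ⟨Real.cos θ, Real.sin θ⟩

namespace OrientedPoint

/-- Centre of the circle of signed radius `ρ` tangent at `P` to the heading of `P`. The circle is
run counter-clockwise (left turn) if `ρ > 0` and clockwise (right turn) if `ρ < 0`. With
`P = ((x, y), θ)` this is the point `(x - ρ sin θ, y + ρ cos θ)`. -/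
def center (ρ : ℝ) (P : OrientedPoint) : ℂ := P.pos + (ρ : ℂ) * Complex.I * unitVec P.angle

/-- Centre of the circle of radius `rmin` that is run by a right turn from `P`. -/
def rightCenter (rmin : ℝ) (P : OrientedPoint) : ℂ := P.center (-rmin)

/-- Centre of the circle of radius `rmin` that is run by a left turn from `P`. -/
def leftCenter (rmin : ℝ) (P : OrientedPoint) : ℂ := P.center rmin

end OrientedPoint

/-- `Λ : [0, s] → ℝ²` is a feasible curvature-bounded trajectory of length `s` from `A` to `B` for
the minimum turn radius `rmin`: it is `C¹` with velocity `V` of norm one, piecewise `C²` (there are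
finitely many break points such that `Λ` is `C²` on each closed interval without a break point in
its interior), it has the prescribed positions and headings at both ends, and its second derivative
has norm at most `1 / rmin` wherever it exists. (If `s = 0`, this forces `A` and `B` to have the
same position and direction.) -/
def IsTrajectory (rmin : ℝ) (A B : OrientedPoint) (s : ℝ) (Λ : ℝ → ℂ) : Prop :=
  0 ≤ s ∧ ∃ V : ℝ → ℂ,
    ContinuousOn V (Icc 0 s) ∧
    (∀ t ∈ Icc 0 s, HasDerivWithinAt Λ (V t) (Icc 0 s) t) ∧
    (∀ t ∈ Icc 0 s, ‖V t‖ = 1) ∧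
    (∃ F : Finset ℝ, ∀ u v : ℝ, 0 ≤ u → u ≤ v → v ≤ s → (∀ t ∈ F, t ∉ Ioo u v) →
      ContDiffOn ℝ 2 Λ (Icc u v)) ∧
    (Λ 0 = A.pos ∧ Λ s = B.pos ∧ V 0 = unitVec A.angle ∧ V s = unitVec B.angle) ∧
    (∀ t ∈ Ioo 0 s, ∀ w : ℂ, HasDerivAt V w t → ‖w‖ ≤ 1 / rmin)

/-- `Λ` is a shortest curvature-bounded trajectory from `A` to `B` (a Dubins shortest path), and
`lm` is its length. -/
def IsDubinsShortestPath (rmin : ℝ) (A B : OrientedPoint) (lm : ℝ) (Λ : ℝ → ℂ) : Prop :=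
  IsTrajectory rmin A B lm Λ ∧
    ∀ (s : ℝ) (Γ : ℝ → ℂ), IsTrajectory rmin A B s Γ → lm ≤ s

/-- What a piece of a trajectory runs along: a circle of signed radius `ρ` (counter-clockwise if
`ρ > 0`, clockwise if `ρ < 0`), or a straight line (the limit of a circle as `|ρ| → ∞`). -/
inductive Track where
  | circle (ρ : ℝ)
  | line

namespace Track

/-- The oriented point reached from `P` after running the length `t` along the track tangent to the
heading of `P` at `P`. -/
def advance : Track → OrientedPoint → ℝ → OrientedPoint
  | circle ρ, P, t =>
    ⟨P.center ρ - (ρ : ℂ) * Complex.I * unitVec (P.angle + t / ρ), P.angle + t / ρ⟩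
  | line, P, t => ⟨P.pos + (t : ℂ) * unitVec P.angle, P.angle⟩

/-- `s` is the length of an arc of the track (possibly degenerate to a point, less than one full
turn on a circle), and the track respects the minimum turn radius `rmin`. -/
def IsArcLength (rmin : ℝ) : Track → ℝ → Prop
  | circle ρ, s => rmin ≤ |ρ| ∧ 0 ≤ s ∧ s < 2 * Real.pi * |ρ|
  | line, s => 0 ≤ s

end Track

/-- The path that starts at `P` and runs the length `s₁` along `γ₁`, then `s₂` along `γ₂`, and then
along `γ₃`, each track being tangent to the preceding one at the changeover point. -/
def concatPath (γ₁ γ₂ γ₃ : Track) (s₁ s₂ : ℝ) (P : OrientedPoint) (t : ℝ) : OrientedPoint :=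
  if t ≤ s₁ then γ₁.advance P t
  else if t ≤ s₁ + s₂ then γ₂.advance (γ₁.advance P s₁) (t - s₁)
  else γ₃.advance (γ₂.advance (γ₁.advance P s₁) s₂) (t - (s₁ + s₂))

/-- `Λ : [0, s₁ + s₂ + s₃] → ℝ²` starts from `A` and is the union of an arc of `γ₁` of length `s₁`,
an arc of `γ₂` of length `s₂` and an arc of `γ₃` of length `s₃`. -/
def IsConcat (rmin : ℝ) (A : OrientedPoint) (γ₁ γ₂ γ₃ : Track) (s₁ s₂ s₃ : ℝ) (Λ : ℝ → ℂ) : Prop :=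
  γ₁.IsArcLength rmin s₁ ∧ γ₂.IsArcLength rmin s₂ ∧ γ₃.IsArcLength rmin s₃ ∧
    ∀ t ∈ Icc 0 (s₁ + s₂ + s₃), Λ t = (concatPath γ₁ γ₂ γ₃ s₁ s₂ A t).pos

/-- The Dubins shortest path `Λ` from `A` to `B` is of the form `C_η S_d C_ζ`: an arc of length `η`
of a circle of radius `rmin`, a segment of length `d`, and an arc of length `ζ` of a circle of radius
`rmin`, with either turning direction (`ε = 1` left, `ε = -1` right) on each circle. -/
def IsShortestCSC (rmin : ℝ) (A B : OrientedPoint) (η d ζ : ℝ) (Λ : ℝ → ℂ) : Prop :=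
  IsDubinsShortestPath rmin A B (η + d + ζ) Λ ∧
    ∃ ε₁ ε₃ : ℝ, (ε₁ = 1 ∨ ε₁ = -1) ∧ (ε₃ = 1 ∨ ε₃ = -1) ∧
      IsConcat rmin A (Track.circle (ε₁ * rmin)) Track.line (Track.circle (ε₃ * rmin)) η d ζ Λ

/-- First arc at least a half turn (arc length at least `π * rmin`). -/
def setO₁ (rmin : ℝ) : Set (OrientedPoint × OrientedPoint) :=
  {p | ∃ (η d ζ : ℝ) (Λ : ℝ → ℂ), IsShortestCSC rmin p.1 p.2 η d ζ Λ ∧ Real.pi * rmin ≤ η}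

/-- Last arc at least a half turn. -/
def setO₂ (rmin : ℝ) : Set (OrientedPoint × OrientedPoint) :=
  {p | ∃ (η d ζ : ℝ) (Λ : ℝ → ℂ), IsShortestCSC rmin p.1 p.2 η d ζ Λ ∧ Real.pi * rmin ≤ ζ}

/-- Straight segment of length at least `4 * rmin`. -/
def setO₃ (rmin : ℝ) : Set (OrientedPoint × OrientedPoint) :=
  {p | ∃ (η d ζ : ℝ) (Λ : ℝ → ℂ), IsShortestCSC rmin p.1 p.2 η d ζ Λ ∧ 4 * rmin ≤ d}

/-- Centres of the two right-turn circles at distance at least `4 * rmin`. -/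
def setO₄ (rmin : ℝ) : Set (OrientedPoint × OrientedPoint) :=
  {p | ∃ (η d ζ : ℝ) (Λ : ℝ → ℂ), IsShortestCSC rmin p.1 p.2 η d ζ Λ ∧
    4 * rmin ≤ dist (p.1.rightCenter rmin) (p.2.rightCenter rmin)}

/-- Centres of the two left-turn circles at distance at least `4 * rmin`. -/
def setO₅ (rmin : ℝ) : Set (OrientedPoint × OrientedPoint) :=
  {p | ∃ (η d ζ : ℝ) (Λ : ℝ → ℂ), IsShortestCSC rmin p.1 p.2 η d ζ Λ ∧
    4 * rmin ≤ dist (p.1.leftCenter rmin) (p.2.leftCenter rmin)}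

/-- The set `𝒪` of pairs of oriented points. -/
def setO (rmin : ℝ) : Set (OrientedPoint × OrientedPoint) :=
  setO₁ rmin ∪ setO₂ rmin ∪ setO₃ rmin ∪ setO₄ rmin ∪ setO₅ rmin

/-- `Λ : [0, l] → ℝ²`, starting from `A`, is a `C^{r₁} C^{r₂} C^{r₃}` path of length `l` with radii at
least `rmin` in absolute value: an arc of a circle of signed radius `r₁`, an arc of `γ₂`, which is
either a circle of signed radius `r₂` or the limiting straight line (`r₂ = ±∞`), and an arc of a
circle of signed radius `r₃`; consecutive tracks are distinct (and tangent at the changeover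
point). -/
def IsCircleCircleCircle (rmin : ℝ) (A : OrientedPoint) (l : ℝ) (Λ : ℝ → ℂ) : Prop :=
  ∃ (r₁ r₃ : ℝ) (γ₂ : Track) (s₁ s₂ s₃ : ℝ),
    Track.circle r₁ ≠ γ₂ ∧ γ₂ ≠ Track.circle r₃ ∧ s₁ + s₂ + s₃ = l ∧
    IsConcat rmin A (Track.circle r₁) γ₂ (Track.circle r₃) s₁ s₂ s₃ Λ

end

/-! ### Tracks and their concatenations as curvature-bounded trajectories -/

noncomputable section

/-! The shortest path is deformed through paths of three tangent arcs. The length depends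
continuously on one parameter in each stage, so the intermediate value theorem yields every length
up to the end of the stage. There an arc has vanished or two arcs have merged, and the next stage
starts, until a last stage whose length is unbounded. After scaling to `rmin = 1` and moving the
start to the origin with heading `1`, this becomes `Elongates`, a statement about `ThreeArc`;
reflection and reversal of paths reduce the number of cases.

The last stage is usually left-right-left with outer radii one (`threeArc_of_isosceles_le`). If `D`
is the distance of the two left centres and the middle arc turns by `2δ`, the length is `X + Y + D /
sinc δ`, which tends to infinity as `δ` tends to `π`. The middle radius is at least one exactly when
`4 sin δ ≤ D`. This is automatic if `D ≥ 4`, and it also persists if the stage starts at some `δ ≥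
π/2`, where the sine decreases. These are the two sources of the hypotheses: distant circles, and an
arc of at least a half turn.

If the first arc is a right arc of at least a half turn, its radius is increased by `R`. Before a
left arc, the segment is bent to the left (`threeArc_of_right_line_left`); before a right arc, the
segment turns and the last arc shrinks (`threeArc_of_right_line_right`). If both arcs are below a
half turn and the left centres are at distance at least four, left-segment-left goes directly to the
last stage. The other types pass through right-right-left paths (`threeArc_of_bend`), preceded for
right-segment-right by bulging the segment (`threeArc_of_right_shrink`). A segment of length at
least four gives distant left or right centres. -/

theorem unitVec_eq_exp (θ : ℝ) : unitVec θ = Complex.exp (θ * Complex.I) := by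
  rw [Complex.exp_mul_I]
  apply Complex.ext <;> simp [unitVec, Complex.cos_ofReal_re, Complex.sin_ofReal_re]

theorem norm_unitVec (θ : ℝ) : ‖unitVec θ‖ = 1 := by
  rw [unitVec_eq_exp, Complex.norm_exp_ofReal_mul_I]

theorem hasDerivAt_unitVec_affine (a k t : ℝ) :
    HasDerivAt (fun s : ℝ => unitVec (a + s * k))
      ((k : ℂ) * Complex.I * unitVec (a + t * k)) t := by
  simp only [unitVec_eq_exp]
  have h : HasDerivAt (fun s : ℝ => (((a + s * k : ℝ) : ℂ) * Complex.I))
      (((1 * k : ℝ) : ℂ) * Complex.I) t :=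
    ((((hasDerivAt_id t).mul_const k).const_add a).ofReal_comp).mul_const _
  convert h.cexp using 1
  push_cast
  ring

theorem contDiff_unitVec_affine (a k : ℝ) {n : WithTop ℕ∞} :
    ContDiff ℝ n (fun s : ℝ => unitVec (a + s * k)) := by
  simp only [unitVec_eq_exp]
  have h : ContDiff ℝ n (fun s : ℝ => (((a + s * k : ℝ) : ℂ))) :=
    Complex.ofRealCLM.contDiff.comp (contDiff_const.add (contDiff_id.mul contDiff_const))
  exact (h.mul contDiff_const).cexp

namespace Track

/-- The signed curvature of a track. -/
def curvature : Track → ℝ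
  | circle ρ => ρ⁻¹
  | line => 0

/-- The track is not a degenerate circle. -/
def Nondegenerate : Track → Prop
  | circle ρ => ρ ≠ 0
  | line => True

theorem IsArcLength.nondegenerate {rmin s : ℝ} (hr : 0 < rmin) {γ : Track}
    (h : γ.IsArcLength rmin s) : γ.Nondegenerate := by
  cases γ with
  | circle ρ => exact abs_pos.1 (hr.trans_le h.1)
  | line => trivial

theorem IsArcLength.nonneg {rmin s : ℝ} {γ : Track} (h : γ.IsArcLength rmin s) : 0 ≤ s := by
  cases γ with
  | circle ρ => exact h.2.1
  | line => exact h

theorem IsArcLength.abs_curvature_le {rmin s : ℝ} (hr : 0 < rmin) {γ : Track}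
    (h : γ.IsArcLength rmin s) : |γ.curvature| ≤ 1 / rmin := by
  cases γ with
  | circle ρ =>
    simp only [curvature, abs_inv, one_div]
    exact inv_anti₀ hr h.1
  | line => simp [curvature, hr.le]

theorem advance_angle (γ : Track) (P : OrientedPoint) (t : ℝ) :
    (γ.advance P t).angle = P.angle + t * γ.curvature := by
  cases γ <;> simp [advance, curvature, div_eq_mul_inv]

theorem advance_zero (γ : Track) (P : OrientedPoint) : γ.advance P 0 = P := by
  cases γ <;> simp [advance, OrientedPoint.center]

theorem hasDerivAt_advance_pos {γ : Track} (hγ : γ.Nondegenerate) (P : OrientedPoint) (t : ℝ) :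
    HasDerivAt (fun s => (γ.advance P s).pos) (unitVec (γ.advance P t).angle) t := by
  cases γ with
  | circle ρ =>
    have hρ : (ρ : ℂ) ≠ 0 := by exact_mod_cast (show ρ ≠ 0 from hγ)
    have h := ((hasDerivAt_unitVec_affine P.angle ρ⁻¹ t).const_mul
      ((ρ : ℂ) * Complex.I)).const_sub (P.center ρ)
    simp only [advance, div_eq_mul_inv]
    refine h.congr_deriv ?_
    push_cast
    have : (ρ : ℂ) * Complex.I * ((ρ : ℂ)⁻¹ * Complex.I * unitVec (P.angle + t * ρ⁻¹))
      = (ρ * (ρ : ℂ)⁻¹) * (Complex.I * Complex.I) * unitVec (P.angle + t * ρ⁻¹) := by ring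
    rw [this, mul_inv_cancel₀ hρ, Complex.I_mul_I]
    ring
  | line =>
    have h := ((hasDerivAt_id t).ofReal_comp.mul_const (unitVec P.angle)).const_add P.pos
    simpa [advance] using h

theorem contDiff_advance_pos (γ : Track) (P : OrientedPoint) {n : WithTop ℕ∞} :
    ContDiff ℝ n (fun s => (γ.advance P s).pos) := by
  cases γ with
  | circle ρ =>
    simp only [advance, div_eq_mul_inv]
    exact contDiff_const.sub (contDiff_const.mul (contDiff_unitVec_affine _ _))
  | line =>
    simp only [advance]
    exact contDiff_const.add (Complex.ofRealCLM.contDiff.mul contDiff_const)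

theorem hasDerivAt_unitVec_advance (γ : Track) (P : OrientedPoint) (t : ℝ) :
    HasDerivAt (fun s => unitVec (γ.advance P s).angle)
      ((γ.curvature : ℂ) * Complex.I * unitVec (γ.advance P t).angle) t := by
  simp only [advance_angle]
  exact hasDerivAt_unitVec_affine _ _ _

end Track

theorem HasDerivAt.ite_le {E : Type*} [NormedAddCommGroup E] [NormedSpace ℝ E] {f g f' g' : ℝ → E}
    {c : ℝ} (hf : ∀ t, HasDerivAt f (f' t) t) (hg : ∀ t, HasDerivAt g (g' t) t)
    (h : f c = g c) (h' : f' c = g' c) (t : ℝ) :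
    HasDerivAt (fun s => if s ≤ c then f s else g s) (if t ≤ c then f' t else g' t) t := by
  rcases lt_trichotomy t c with htc | rfl | htc
  · rw [if_pos htc.le]
    refine (hf t).congr_of_eventuallyEq ?_
    filter_upwards [Iio_mem_nhds htc] with s hs
    rw [if_pos (le_of_lt hs)]
  · rw [if_pos le_rfl, ← hasDerivWithinAt_univ, ← Iic_union_Ici (a := t)]
    refine HasDerivWithinAt.union ?_ ?_
    · refine (hf t).hasDerivWithinAt.congr (fun s hs => if_pos hs) (if_pos le_rfl)
    · rw [h']
      refine (hg t).hasDerivWithinAt.congr (fun s hs => ?_) ?_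
      · rcases eq_or_lt_of_le (show t ≤ s from hs) with rfl | hlt
        · rw [if_pos le_rfl, h]
        · rw [if_neg (not_le.2 hlt)]
      · rw [if_pos le_rfl, h]
  · rw [if_neg (not_le.2 htc)]
    refine (hg t).congr_of_eventuallyEq ?_
    filter_upwards [Ioi_mem_nhds htc] with s hs
    rw [if_neg (not_le.2 hs)]

section Concat

variable {γ₁ γ₂ γ₃ : Track} {s₁ s₂ s₃ rmin : ℝ} {P A B : OrientedPoint}

theorem hasDerivAt_concatPath_pos (h₁ : γ₁.Nondegenerate) (h₂ : γ₂.Nondegenerate)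
    (h₃ : γ₃.Nondegenerate) (hs₂ : 0 ≤ s₂) (t : ℝ) :
    HasDerivAt (fun t => (concatPath γ₁ γ₂ γ₃ s₁ s₂ P t).pos)
      (unitVec (concatPath γ₁ γ₂ γ₃ s₁ s₂ P t).angle) t := by
  have key := HasDerivAt.ite_le (c := s₁) (Track.hasDerivAt_advance_pos h₁ P)
    (HasDerivAt.ite_le (c := s₁ + s₂)
      (fun t => (Track.hasDerivAt_advance_pos h₂ (γ₁.advance P s₁) (t - s₁)).comp_sub_const t s₁)
      (fun t => (Track.hasDerivAt_advance_pos h₃ (γ₂.advance (γ₁.advance P s₁) s₂)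
        (t - (s₁ + s₂))).comp_sub_const t (s₁ + s₂))
      (by simp [Track.advance_zero]) (by simp [Track.advance_zero]))
    (by simp [Track.advance_zero, hs₂]) (by simp [Track.advance_zero, hs₂]) t
  simp only [concatPath, apply_ite OrientedPoint.pos, apply_ite OrientedPoint.angle,
    apply_ite unitVec]
  exact key

theorem continuous_unitVec_concatPath (hs₂ : 0 ≤ s₂) :
    Continuous (fun t => unitVec (concatPath γ₁ γ₂ γ₃ s₁ s₂ P t).angle) := by
  have hu : Continuous unitVec := by
    have : unitVec = fun s : ℝ => unitVec (0 + s * 1) := by funext s; simp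
    rw [this]
    exact (contDiff_unitVec_affine 0 1 (n := 0)).continuous
  refine hu.comp ?_
  have : (fun t => (concatPath γ₁ γ₂ γ₃ s₁ s₂ P t).angle) = fun t =>
      if t ≤ s₁ then P.angle + t * γ₁.curvature
      else if t ≤ s₁ + s₂ then P.angle + s₁ * γ₁.curvature + (t - s₁) * γ₂.curvature
      else P.angle + s₁ * γ₁.curvature + s₂ * γ₂.curvature + (t - (s₁ + s₂)) * γ₃.curvature := by
    funext t
    simp only [concatPath]
    split_ifs <;> simp [Track.advance_angle]
  rw [this]
  refine Continuous.if_le (by fun_prop) (Continuous.if_le (by fun_prop) (by fun_prop)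
    (by fun_prop) (by fun_prop) ?_) (by fun_prop) (by fun_prop) ?_
  · rintro t rfl; ring
  · rintro t rfl; simp [hs₂]

theorem concatPath_zero (h₁ : 0 ≤ s₁) : concatPath γ₁ γ₂ γ₃ s₁ s₂ P 0 = P := by
  simp [concatPath, h₁, Track.advance_zero]

theorem concatPath_end (h₂ : 0 ≤ s₂) (h₃ : 0 ≤ s₃) :
    concatPath γ₁ γ₂ γ₃ s₁ s₂ P (s₁ + s₂ + s₃)
      = γ₃.advance (γ₂.advance (γ₁.advance P s₁) s₂) s₃ := by
  rcases h₃.eq_or_lt with rfl | h₃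
  · rcases h₂.eq_or_lt with rfl | h₂
    · simp [concatPath, Track.advance_zero]
    · have : ¬ (s₁ + s₂ ≤ s₁) := by linarith
      simp [concatPath, Track.advance_zero, this]
  · have a : ¬ (s₁ + s₂ + s₃ ≤ s₁) := by linarith
    have b : ¬ (s₁ + s₂ + s₃ ≤ s₁ + s₂) := by linarith
    simp only [concatPath, if_neg a, if_neg b]
    congr 1
    ring

theorem contDiffOn_concatPath_pos (h₂ : 0 ≤ s₂) {u v : ℝ} (h : s₁ ∉ Ioo u v)
    (h' : s₁ + s₂ ∉ Ioo u v) :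
    ContDiffOn ℝ 2 (fun t => (concatPath γ₁ γ₂ γ₃ s₁ s₂ P t).pos) (Icc u v) := by
  by_cases hv : v ≤ s₁
  · refine (γ₁.contDiff_advance_pos P).contDiffOn.congr fun t ht => ?_
    simp [concatPath, ht.2.trans hv]
  have hu : s₁ ≤ u := by
    by_contra hu
    exact h ⟨not_le.1 hu, not_le.1 hv⟩
  by_cases hv' : v ≤ s₁ + s₂
  · refine ((γ₂.contDiff_advance_pos (γ₁.advance P s₁)).comp
      (contDiff_id.sub contDiff_const : ContDiff ℝ 2 fun t : ℝ => t - s₁)).contDiffOn.congr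
        fun t ht => ?_
    rcases (hu.trans ht.1).eq_or_lt with rfl | hlt
    · simp [concatPath, Track.advance_zero]
    · simp [concatPath, ht.2.trans hv', not_le.2 hlt]
  have hu' : s₁ + s₂ ≤ u := by
    by_contra hu
    exact h' ⟨not_le.1 hu, not_le.1 hv'⟩
  refine ((γ₃.contDiff_advance_pos (γ₂.advance (γ₁.advance P s₁) s₂)).comp
      (contDiff_id.sub contDiff_const : ContDiff ℝ 2 fun t : ℝ => t - (s₁ + s₂))).contDiffOn.congr
        fun t ht => ?_
  rcases (hu'.trans ht.1).eq_or_lt with rfl | hlt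
  · have := @concatPath_end γ₁ γ₂ γ₃ s₁ s₂ 0 P h₂ le_rfl
    simp only [add_zero] at this
    simp [this]
  · have : ¬ t ≤ s₁ := by linarith
    simp [concatPath, this, not_le.2 hlt]

/-- Immediately to the right of any `t` the path runs along a single track, so a derivative of the
velocity at `t`, if there is one, equals the right derivative, whose norm is the curvature of that
track. Break points therefore need no separate treatment. -/
theorem norm_deriv_unitVec_concatPath_le (hr : 0 < rmin) (h₁ : γ₁.IsArcLength rmin s₁)
    (h₂ : γ₂.IsArcLength rmin s₂) (h₃ : γ₃.IsArcLength rmin s₃) {t : ℝ} {w : ℂ}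
    (hw : HasDerivAt (fun t => unitVec (concatPath γ₁ γ₂ γ₃ s₁ s₂ P t).angle) w t) :
    ‖w‖ ≤ 1 / rmin := by
  have aux : ∀ {γ : Track} {Q : OrientedPoint} {c : ℝ}, |γ.curvature| ≤ 1 / rmin →
      (∀ᶠ s in nhdsWithin t (Ioi t), concatPath γ₁ γ₂ γ₃ s₁ s₂ P s = γ.advance Q (s - c)) →
      ‖w‖ ≤ 1 / rmin := by
    intro γ Q c hγ hev
    have hd := ((Track.hasDerivAt_unitVec_advance γ Q (t - c)).comp_sub_const t c)
    have hcont := (continuous_unitVec_concatPath (γ₁ := γ₁) (γ₂ := γ₂) (γ₃ := γ₃) (s₁ := s₁)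
      (P := P) h₂.nonneg).continuousAt (x := t)
    have hev' : (fun s => unitVec (concatPath γ₁ γ₂ γ₃ s₁ s₂ P s).angle)
        =ᶠ[nhdsWithin t (Ioi t)] fun s => unitVec (γ.advance Q (s - c)).angle := by
      filter_upwards [hev] with s hs
      rw [hs]
    have heq : unitVec (concatPath γ₁ γ₂ γ₃ s₁ s₂ P t).angle
        = unitVec (γ.advance Q (t - c)).angle :=
      tendsto_nhds_unique
        ((hcont.tendsto.mono_left nhdsWithin_le_nhds).congr' hev')
        (hd.continuousAt.tendsto.mono_left nhdsWithin_le_nhds)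
    have := (hd.hasDerivWithinAt (s := Ioi t)).congr_of_eventuallyEq hev' heq
    rw [UniqueDiffWithinAt.eq_deriv _ (uniqueDiffWithinAt_Ioi t) hw.hasDerivWithinAt this]
    simpa [norm_unitVec] using hγ
  by_cases ht : t < s₁
  · refine aux (γ := γ₁) (Q := P) (c := 0) (h₁.abs_curvature_le hr) ?_
    filter_upwards [nhdsWithin_le_nhds (Iio_mem_nhds ht)] with s hs
    simp [concatPath, le_of_lt (show s < s₁ from hs)]
  by_cases ht' : t < s₁ + s₂
  · refine aux (γ := γ₂) (Q := γ₁.advance P s₁) (c := s₁) (h₂.abs_curvature_le hr) ?_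
    filter_upwards [nhdsWithin_le_nhds (Iio_mem_nhds ht'), self_mem_nhdsWithin] with s hs hs'
    have : ¬ s ≤ s₁ := not_le.2 ((not_lt.1 ht).trans_lt hs')
    simp [concatPath, this, le_of_lt (show s < s₁ + s₂ from hs)]
  · refine aux (γ := γ₃) (Q := γ₂.advance (γ₁.advance P s₁) s₂) (c := s₁ + s₂)
      (h₃.abs_curvature_le hr) ?_
    filter_upwards [self_mem_nhdsWithin] with s hs'
    have a : ¬ s ≤ s₁ := not_le.2 ((not_lt.1 ht).trans_lt hs')
    have b : ¬ s ≤ s₁ + s₂ := not_le.2 ((not_lt.1 ht').trans_lt hs')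
    simp [concatPath, a, b]

theorem isTrajectory_concatPath (hr : 0 < rmin) (h₁ : γ₁.IsArcLength rmin s₁)
    (h₂ : γ₂.IsArcLength rmin s₂) (h₃ : γ₃.IsArcLength rmin s₃)
    (hpos : (γ₃.advance (γ₂.advance (γ₁.advance A s₁) s₂) s₃).pos = B.pos)
    (hang : unitVec (γ₃.advance (γ₂.advance (γ₁.advance A s₁) s₂) s₃).angle = unitVec B.angle) :
    IsTrajectory rmin A B (s₁ + s₂ + s₃) (fun t => (concatPath γ₁ γ₂ γ₃ s₁ s₂ A t).pos) := by
  refine ⟨add_nonneg (add_nonneg h₁.nonneg h₂.nonneg) h₃.nonneg,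
    fun t => unitVec (concatPath γ₁ γ₂ γ₃ s₁ s₂ A t).angle,
    (continuous_unitVec_concatPath h₂.nonneg).continuousOn,
    fun t _ => (hasDerivAt_concatPath_pos (h₁.nondegenerate hr) (h₂.nondegenerate hr)
      (h₃.nondegenerate hr) h₂.nonneg t).hasDerivWithinAt,
    fun t _ => norm_unitVec _, ⟨{s₁, s₁ + s₂}, fun u v _ _ _ h => ?_⟩, ⟨?_, ?_, ?_, ?_⟩,
    fun t _ w hw => norm_deriv_unitVec_concatPath_le hr h₁ h₂ h₃ hw⟩
  · exact contDiffOn_concatPath_pos h₂.nonneg (h _ (by simp)) (h _ (by simp))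
  · simp only [concatPath_zero h₁.nonneg]
  · simp only [concatPath_end h₂.nonneg h₃.nonneg, hpos]
  · simp only [concatPath_zero h₁.nonneg]
  · simp only [concatPath_end h₂.nonneg h₃.nonneg, hang]

theorem IsConcat.end_eq {Λ : ℝ → ℂ} (hr : 0 < rmin) (hc : IsConcat rmin A γ₁ γ₂ γ₃ s₁ s₂ s₃ Λ)
    (ht : IsTrajectory rmin A B (s₁ + s₂ + s₃) Λ) :
    (γ₃.advance (γ₂.advance (γ₁.advance A s₁) s₂) s₃).pos = B.pos ∧
      unitVec (γ₃.advance (γ₂.advance (γ₁.advance A s₁) s₂) s₃).angle = unitVec B.angle := by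
  obtain ⟨h₁, h₂, h₃, hΛ⟩ := hc
  obtain ⟨hs, V, -, hV, -, -, ⟨-, hB, hVA, hVB⟩, -⟩ := ht
  rw [← concatPath_end h₂.nonneg h₃.nonneg]
  refine ⟨by rw [← hB, hΛ _ ⟨hs, le_rfl⟩], ?_⟩
  -- On a one-point interval derivatives are not unique; there the two prescribed end velocities are
  -- compared directly.
  rcases hs.eq_or_lt with h0 | hpos
  · rw [← h0, concatPath_zero h₁.nonneg, ← hVB, ← h0, hVA]
  · rw [← hVB]
    have hmem : s₁ + s₂ + s₃ ∈ Icc 0 (s₁ + s₂ + s₃) := ⟨hs, le_rfl⟩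
    have hd := (hasDerivAt_concatPath_pos (P := A) (s₁ := s₁) (h₁.nondegenerate hr)
      (h₂.nondegenerate hr) (h₃.nondegenerate hr) h₂.nonneg (s₁ + s₂ + s₃)).hasDerivWithinAt
        (s := Icc 0 (s₁ + s₂ + s₃))
    exact UniqueDiffWithinAt.eq_deriv _ (uniqueDiffOn_Icc hpos _ hmem)
      (hd.congr hΛ (hΛ _ hmem)) (hV _ hmem)

end Concat

/-! ### Normalised three-arc paths and their symmetries -/

/-- The unit complex number with argument `t`. -/
def cis (t : ℝ) : ℂ := Complex.exp (t * Complex.I)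

theorem cis_zero : cis 0 = 1 := by simp [cis]

theorem cis_add (s t : ℝ) : cis (s + t) = cis s * cis t := by
  simp [cis, ← Complex.exp_add, add_mul]

theorem cis_re (t : ℝ) : (cis t).re = Real.cos t := Complex.exp_ofReal_mul_I_re t

theorem cis_im (t : ℝ) : (cis t).im = Real.sin t := Complex.exp_ofReal_mul_I_im t

theorem norm_cis (t : ℝ) : ‖cis t‖ = 1 := Complex.norm_exp_ofReal_mul_I t

theorem conj_cis (t : ℝ) : (starRingEnd ℂ) (cis t) = cis (-t) := by
  apply Complex.ext <;> simp [cis_re, cis_im]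

theorem cis_mul_cis_neg (t : ℝ) : cis t * cis (-t) = 1 := by
  rw [← cis_add, add_neg_cancel, cis_zero]

theorem cis_sub_two_pi (t : ℝ) : cis (t - 2 * Real.pi) = cis t := by
  apply Complex.ext <;> simp [cis_re, cis_im]

theorem unitVec_add (a t : ℝ) : unitVec (a + t) = unitVec a * cis t := by
  rw [unitVec_eq_exp, unitVec_eq_exp]
  exact cis_add a t

/-- An arc of signed radius `r` (at least one in absolute value) with signed turning angle `t`. -/
structure IsArc (r t : ℝ) : Prop where
  one_le : 1 ≤ |r|
  nonneg : 0 ≤ r * t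
  lt : |t| < 2 * Real.pi

/-- There is a path made of three tangent arcs, of signed radii at least one in absolute value
(the middle one may be a segment), of length `l`, from the origin with heading `1` to `z` with
heading `v`. -/
def ThreeArc (z v : ℂ) (l : ℝ) : Prop :=
  ∃ r₁ t₁ r₃ t₃ : ℝ, IsArc r₁ t₁ ∧ IsArc r₃ t₃ ∧
    ((∃ r₂ t₂ : ℝ, IsArc r₂ t₂ ∧ r₁ ≠ r₂ ∧ r₂ ≠ r₃ ∧ v = cis (t₁ + t₂ + t₃) ∧
        z = Complex.I * (r₁ * (1 - cis t₁) + r₂ * (cis t₁ - cis (t₁ + t₂))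
          + r₃ * (cis (t₁ + t₂) - v)) ∧
        l = r₁ * t₁ + r₂ * t₂ + r₃ * t₃) ∨
      (∃ d : ℝ, 0 ≤ d ∧ v = cis (t₁ + t₃) ∧
        z = Complex.I * (r₁ * (1 - cis t₁) + r₃ * (cis t₁ - v)) + d * cis t₁ ∧
        l = r₁ * t₁ + d + r₃ * t₃))

theorem IsArc.neg {r t : ℝ} (h : IsArc r t) : IsArc (-r) (-t) :=
  ⟨by simpa using h.one_le, by simpa using h.nonneg, by simpa using h.lt⟩

theorem IsArc.pos {r t : ℝ} (hr : 1 ≤ r) (ht : 0 ≤ t) (ht' : t < 2 * Real.pi) : IsArc r t :=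
  ⟨hr.trans (le_abs_self r), by positivity, by rwa [abs_of_nonneg ht]⟩

theorem ThreeArc.conj {z v : ℂ} {l : ℝ} (h : ThreeArc z v l) :
    ThreeArc ((starRingEnd ℂ) z) ((starRingEnd ℂ) v) l := by
  obtain ⟨r₁, t₁, r₃, t₃, h₁, h₃, h⟩ := h
  refine ⟨-r₁, -t₁, -r₃, -t₃, h₁.neg, h₃.neg, ?_⟩
  rcases h with ⟨r₂, t₂, h₂, h₁₂, h₂₃, hv, hz, hl⟩ | ⟨d, hd, hv, hz, hl⟩
  · refine Or.inl ⟨-r₂, -t₂, h₂.neg, by simpa using h₁₂, by simpa using h₂₃, ?_, ?_, ?_⟩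
    · rw [hv, conj_cis]; congr 1; ring
    · have e : -t₁ + -t₂ = -(t₁ + t₂) := by ring
      rw [hz, e, ← conj_cis, ← conj_cis]
      simp only [map_mul, map_add, map_sub, Complex.conj_I, Complex.conj_ofReal, map_one]
      push_cast
      ring
    · rw [hl]; ring
  · refine Or.inr ⟨d, hd, ?_, ?_, ?_⟩
    · rw [hv, conj_cis]; congr 1; ring
    · rw [hz, ← conj_cis]
      simp only [map_mul, map_add, map_sub, Complex.conj_I, Complex.conj_ofReal, map_one]
      push_cast
      ring
    · rw [hl]; ring

/-- Running a path backwards and reflecting it. -/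
theorem ThreeArc.conj_reverse {z v : ℂ} {l : ℝ} (h : ThreeArc z v l) :
    ThreeArc (v * (starRingEnd ℂ) z) v l := by
  obtain ⟨r₁, t₁, r₃, t₃, h₁, h₃, h⟩ := h
  refine ⟨r₃, t₃, r₁, t₁, h₃, h₁, ?_⟩
  rcases h with ⟨r₂, t₂, h₂, h₁₂, h₂₃, hv, hz, hl⟩ | ⟨d, hd, hv, hz, hl⟩
  · refine Or.inl ⟨r₂, t₂, h₂, h₂₃.symm, h₁₂.symm, ?_, ?_, ?_⟩
    · rw [hv]; congr 1; ring
    · rw [hz, hv]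
      simp only [map_mul, map_add, map_sub, Complex.conj_I, Complex.conj_ofReal, map_one, conj_cis]
      have a := cis_mul_cis_neg t₁
      have b := cis_mul_cis_neg (t₁ + t₂)
      have c := cis_mul_cis_neg (t₁ + t₂ + t₃)
      have e : cis (t₃ + t₂) = cis (t₁ + t₂ + t₃) * cis (-t₁) := by
        rw [← cis_add]; congr 1; ring
      have f : cis t₃ = cis (t₁ + t₂ + t₃) * cis (-(t₁ + t₂)) := by
        rw [← cis_add]; congr 1; ring
      rw [e, f]
      linear_combination (-Complex.I * (r₃ : ℂ)) * (-c)
    · rw [hl]; ring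
  · refine Or.inr ⟨d, hd, ?_, ?_, ?_⟩
    · rw [hv]; congr 1; ring
    · rw [hz, hv]
      simp only [map_mul, map_add, map_sub, Complex.conj_I, Complex.conj_ofReal, map_one, conj_cis]
      have c := cis_mul_cis_neg (t₁ + t₃)
      have f : cis t₃ = cis (t₁ + t₃) * cis (-t₁) := by
        rw [← cis_add]; congr 1; ring
      rw [f]
      linear_combination (-Complex.I * (r₃ : ℂ)) * (-c)
    · rw [hl]; ring

theorem threeArc_conj_iff {z v : ℂ} {l : ℝ} :
    ThreeArc ((starRingEnd ℂ) z) ((starRingEnd ℂ) v) l ↔ ThreeArc z v l :=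
  ⟨fun h => by simpa using h.conj, ThreeArc.conj⟩

theorem threeArc_conj_reverse_iff {z : ℂ} {a l : ℝ} :
    ThreeArc (cis a * (starRingEnd ℂ) z) (cis a) l ↔ ThreeArc z (cis a) l := by
  refine ⟨fun h => ?_, ThreeArc.conj_reverse⟩
  have := h.conj_reverse
  rwa [map_mul, Complex.conj_conj, conj_cis, ← mul_assoc, cis_mul_cis_neg, one_mul] at this

theorem Track.advance_circle_mul {ρ : ℝ} (hρ : ρ ≠ 0) (P : OrientedPoint) (t : ℝ) :
    (Track.circle ρ).advance P (ρ * t)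
      = ⟨P.pos + ρ * Complex.I * unitVec P.angle * (1 - cis t), P.angle + t⟩ := by
  simp only [Track.advance, mul_div_cancel_left₀ _ hρ, unitVec_add, OrientedPoint.center]
  congr 1
  ring

theorem IsArc.isArcLength {rmin r t : ℝ} (hr : 0 < rmin) (h : IsArc r t) :
    (Track.circle (rmin * r)).IsArcLength rmin (rmin * r * t) := by
  refine ⟨?_, ?_, ?_⟩
  · rw [abs_mul, abs_of_pos hr]
    nlinarith [h.one_le]
  · rw [mul_assoc]
    exact mul_nonneg hr.le h.nonneg
  · have hpos : 0 < |r| := lt_of_lt_of_le one_pos h.one_le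
    rw [mul_assoc, abs_mul, abs_of_pos hr, ← abs_of_nonneg h.nonneg, abs_mul]
    have := mul_lt_mul_of_pos_left h.lt (mul_pos hr hpos)
    linarith

theorem ThreeArc.exists_trajectory {rmin l : ℝ} (hr : 0 < rmin) {A B : OrientedPoint} {z v : ℂ}
    (h : ThreeArc z v l) (hz : B.pos = A.pos + rmin * unitVec A.angle * z)
    (hv : unitVec B.angle = unitVec A.angle * v) :
    ∃ Λ : ℝ → ℂ, IsTrajectory rmin A B (rmin * l) Λ ∧ IsCircleCircleCircle rmin A (rmin * l) Λ := by
  obtain ⟨r₁, t₁, r₃, t₃, h₁, h₃, h⟩ := h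
  have ne : ∀ {r t : ℝ}, IsArc r t → rmin * r ≠ 0 := fun h =>
    mul_ne_zero hr.ne' (abs_pos.1 (lt_of_lt_of_le one_pos h.one_le))
  rcases h with ⟨r₂, t₂, h₂, h₁₂, h₂₃, hv', hz', hl⟩ | ⟨d, hd, hv', hz', hl⟩
  · have hlen : rmin * l = rmin * r₁ * t₁ + rmin * r₂ * t₂ + rmin * r₃ * t₃ := by rw [hl]; ring
    refine ⟨fun t => (concatPath (.circle (rmin * r₁)) (.circle (rmin * r₂)) (.circle (rmin * r₃))
      (rmin * r₁ * t₁) (rmin * r₂ * t₂) A t).pos, ?_, ?_⟩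
    · rw [hlen]
      refine isTrajectory_concatPath hr (h₁.isArcLength hr) (h₂.isArcLength hr)
        (h₃.isArcLength hr) ?_ ?_
      · rw [Track.advance_circle_mul (ne h₁), Track.advance_circle_mul (ne h₂),
          Track.advance_circle_mul (ne h₃)]
        simp only [unitVec_add]
        rw [hz, hz', hv', cis_add (t₁ + t₂), cis_add t₁]
        push_cast
        ring
      · rw [Track.advance_circle_mul (ne h₁), Track.advance_circle_mul (ne h₂),
          Track.advance_circle_mul (ne h₃)]
        simp only [unitVec_add]
        rw [hv, hv', cis_add, cis_add]
        ring
    · refine ⟨rmin * r₁, rmin * r₃, .circle (rmin * r₂), rmin * r₁ * t₁, rmin * r₂ * t₂,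
        rmin * r₃ * t₃, ?_, ?_, hlen.symm, h₁.isArcLength hr, h₂.isArcLength hr,
        h₃.isArcLength hr, fun t _ => rfl⟩
      · simpa [hr.ne'] using h₁₂
      · simpa [hr.ne'] using h₂₃
  · have hlen : rmin * l = rmin * r₁ * t₁ + rmin * d + rmin * r₃ * t₃ := by rw [hl]; ring
    have hd' : Track.line.IsArcLength rmin (rmin * d) := mul_nonneg hr.le hd
    refine ⟨fun t => (concatPath (.circle (rmin * r₁)) .line (.circle (rmin * r₃))
      (rmin * r₁ * t₁) (rmin * d) A t).pos, ?_, ?_⟩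
    · rw [hlen]
      refine isTrajectory_concatPath hr (h₁.isArcLength hr) hd' (h₃.isArcLength hr) ?_ ?_
      · rw [Track.advance_circle_mul (ne h₁), Track.advance_circle_mul (ne h₃)]
        simp only [Track.advance, unitVec_add]
        rw [hz, hz', hv', cis_add]
        push_cast
        ring
      · rw [Track.advance_circle_mul (ne h₁), Track.advance_circle_mul (ne h₃)]
        simp only [Track.advance, unitVec_add]
        rw [hv, hv', cis_add]
        ring
    · exact ⟨rmin * r₁, rmin * r₃, .line, rmin * r₁ * t₁, rmin * d,
        rmin * r₃ * t₃, by simp, by simp, hlen.symm, h₁.isArcLength hr, hd',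
        h₃.isArcLength hr, fun t _ => rfl⟩

/-! ### Deformations governed by an isosceles triangle -/

theorem mul_sinc (x : ℝ) : x * Real.sinc x = Real.sin x := by
  by_cases h : x = 0
  · simp [h]
  · rw [Real.sinc_of_ne_zero h, mul_div_cancel₀ _ h]

theorem sinc_pos {x : ℝ} (h₀ : 0 ≤ x) (h : x < Real.pi) : 0 < Real.sinc x := by
  rcases h₀.eq_or_lt with rfl | h₀
  · simp
  · rw [Real.sinc_of_ne_zero h₀.ne']
    exact div_pos (Real.sin_pos_of_pos_of_lt_pi h₀ h) h₀

theorem cis_isosceles (X δ : ℝ) :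
    Complex.I * (cis (X + δ) - cis (X - δ)) = -(2 * Real.sin δ : ℝ) * cis X := by
  rw [cis_add, sub_eq_add_neg X δ, cis_add]
  apply Complex.ext <;> simp [cis_re, cis_im, -Complex.ofReal_sin] <;> ring

/-- The outer circles have radius one and the middle centre lies at distance `ρ + 1` from both outer
centres, so the three centres form an isosceles triangle with base `D = 2 (ρ + 1) sin δ`. The arcs
turn by `X + δ`, `-2δ`, `Y + δ`, which gives the total length `X + Y + D / sinc δ`. -/
theorem threeArc_of_isosceles {z v : ℂ} {D X Y L δ : ℝ} (hδ : 0 < δ) (hδπ : δ < Real.pi)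
    (hX₀ : 0 ≤ X + δ) (hX : X + δ < 2 * Real.pi) (hY₀ : 0 ≤ Y + δ) (hY : Y + δ < 2 * Real.pi)
    (hD : 4 * Real.sin δ ≤ D) (hL : (L - X - Y) * Real.sinc δ = D)
    (hv : v = cis (X + Y)) (hz : z = Complex.I * (1 - v) + D * cis X) : ThreeArc z v L := by
  have hs : 0 < Real.sin δ := Real.sin_pos_of_pos_of_lt_pi hδ hδπ
  have hr : 1 ≤ D / (2 * Real.sin δ) - 1 := by
    rw [le_sub_iff_add_le, le_div_iff₀ (by positivity)]
    linarith
  have hq : D / (2 * Real.sin δ) * (2 * Real.sin δ) = D := div_mul_cancel₀ _ (by positivity)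
  refine ⟨1, X + δ, 1, Y + δ, .pos le_rfl hX₀ hX, .pos le_rfl hY₀ hY,
    Or.inl ⟨-(D / (2 * Real.sin δ) - 1), -(2 * δ),
      (IsArc.pos hr (by positivity) (by linarith)).neg, by linarith, by linarith, ?_, ?_, ?_⟩⟩
  · rw [hv]; congr 1; ring
  · have e : X + δ + -(2 * δ) = X - δ := by ring
    have h := cis_isosceles X δ
    have hq' : ((D / (2 * Real.sin δ) : ℝ) : ℂ) * (2 * Real.sin δ : ℝ) = D := by exact_mod_cast hq
    rw [hz, e, ← hq']
    push_cast at h ⊢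
    linear_combination (((D : ℂ) / (2 * Complex.sin δ))) * h
  · have h1 := mul_sinc δ
    have : L - X - Y = 2 * δ * (D / (2 * Real.sin δ)) := by
      rw [← hL, ← h1]
      have := (sinc_pos hδ.le hδπ).ne'
      field_simp
    linear_combination this

/-- `sinc` vanishes at `π`, so the intermediate value theorem applies on `[δ₀, π]`; this is what
makes the attainable lengths unbounded. -/
theorem exists_mul_sinc_eq {M D δ₀ : ℝ} (hδ₀ : δ₀ < Real.pi) (hD : 0 < D)
    (h : D ≤ M * Real.sinc δ₀) : ∃ δ, δ₀ ≤ δ ∧ δ < Real.pi ∧ M * Real.sinc δ = D := by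
  have hπ : Real.sinc Real.pi = 0 := by
    rw [Real.sinc_of_ne_zero Real.pi_ne_zero, Real.sin_pi, zero_div]
  obtain ⟨δ, hδ, hδD⟩ := intermediate_value_Icc' (f := fun δ => M * Real.sinc δ) hδ₀.le
    (continuous_const.mul Real.continuous_sinc).continuousOn
    (show D ∈ Icc _ _ from ⟨by simp [hπ, hD.le], h⟩)
  refine ⟨δ, hδ.1, hδ.2.lt_of_ne ?_, hδD⟩
  rintro rfl
  simp [hπ] at hδD
  linarith

/-- Extending a left-right-left path with outer radii one: the two outer arcs keep growing. -/
theorem threeArc_of_isosceles_le {z v : ℂ} {D X Y L δ₀ : ℝ} (hδ₀ : 0 ≤ δ₀) (hδπ : δ₀ < Real.pi)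
    (hX₀ : 0 ≤ X + δ₀) (hX : X ≤ Real.pi) (hY₀ : 0 ≤ Y + δ₀) (hY : Y + δ₀ < 2 * Real.pi)
    (hD₀ : 0 < D) (hD : ∀ δ, δ₀ ≤ δ → δ < Real.pi → 4 * Real.sin δ ≤ D)
    (h₀ : 0 < δ₀ ∨ D < L - X - Y) (hL : D ≤ (L - X - Y) * Real.sinc δ₀)
    (hv : v = cis (X + Y)) (hz : z = Complex.I * (1 - v) + D * cis X) : ThreeArc z v L := by
  obtain ⟨δ, h1, h2, h3⟩ := exists_mul_sinc_eq hδπ hD₀ hL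
  have hδ : 0 < δ := by
    rcases h₀ with h | h
    · linarith
    · refine (hδ₀.trans h1).lt_of_ne ?_
      rintro rfl
      simp at h3
      linarith
  -- If the last arc would reach a full turn, that turn is dropped and the lost length is made up by
  -- a larger `δ'`, found by the same argument started at `δ`.
  by_cases hw : Y + δ < 2 * Real.pi
  · exact threeArc_of_isosceles hδ h2 (by linarith) (by linarith) (by linarith) hw
      (hD δ h1 h2) h3 hv hz
  · obtain ⟨δ', h1', h2', h3'⟩ := exists_mul_sinc_eq (M := L - X - (Y - 2 * Real.pi)) h2 hD₀ (by
      have := sinc_pos hδ.le h2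
      nlinarith [Real.pi_pos])
    refine threeArc_of_isosceles (hδ.trans_le h1') h2' (by linarith) (by linarith)
      (by linarith) (by linarith [Real.pi_pos]) (hD δ' (h1.trans h1') h2') h3' ?_ hz
    rw [hv, ← cis_sub_two_pi]
    congr 1
    ring

theorem cis_chord (δ : ℝ) :
    Complex.I * (cis (-(2 * δ)) - 1) = (2 * Real.sin δ : ℝ) * cis (-δ) := by
  have h := cis_isosceles (-δ) δ
  have e1 : -δ + δ = 0 := by ring
  have e2 : -δ - δ = -(2 * δ) := by ring
  rw [e1, e2, cis_zero] at h
  linear_combination -h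

/-- A right arc of at least a half turn followed by a left arc of radius one. -/
theorem threeArc_of_right_left {z v : ℂ} {r φ y L : ℝ} (hr : 1 ≤ r) (hφ : Real.pi ≤ φ)
    (hφ' : φ < 2 * Real.pi) (hy : 0 ≤ y) (hy' : y < 4 * Real.pi) (hv : v = cis (y - φ))
    (hz : z = Complex.I * (1 - v) + Complex.I * (r + 1) * (cis (-φ) - 1))
    (hL : r * φ + y ≤ L) : ThreeArc z v L := by
  -- The final arc may arise by merging two arcs and exceed a full turn, which is then cut off; this
  -- only shortens the path.
  wlog hy2 : y < 2 * Real.pi generalizing y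
  · refine this (y := y - 2 * Real.pi) (by linarith) (by linarith) ?_
      (by linarith [Real.pi_pos]) (by linarith [Real.pi_pos])
    rw [hv, ← cis_sub_two_pi]
    congr 1
    ring
  have hπ := Real.pi_pos
  have hs : 0 < Real.sin (φ / 2) :=
    Real.sin_pos_of_pos_of_lt_pi (by linarith) (by linarith)
  have hsinc : 0 < Real.sinc (φ / 2) := sinc_pos (by linarith) (by linarith)
  refine threeArc_of_isosceles_le (δ₀ := φ / 2) (X := -(φ / 2)) (Y := y - φ / 2)
    (D := 2 * (r + 1) * Real.sin (φ / 2)) (by linarith) (by linarith) (by linarith)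
    (by linarith) (by linarith) (by linarith) (by positivity) ?_ (Or.inl (by linarith)) ?_ ?_ ?_
  · intro δ h1 h2
    have : Real.sin δ ≤ Real.sin (φ / 2) := by
      rw [← Real.sin_pi_sub δ, ← Real.sin_pi_sub (φ / 2)]
      exact Real.sin_le_sin_of_le_of_le_pi_div_two (by linarith) (by linarith) (by linarith)
    nlinarith
  · rw [← mul_sinc]
    nlinarith
  · rw [hv]; congr 1; ring
  · have h := cis_chord (φ / 2)
    have e : -(2 * (φ / 2)) = -φ := by ring
    rw [e] at h
    rw [hz]
    push_cast at h ⊢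
    linear_combination (r + 1 : ℂ) * h

/-- Replacing the segment of a right-segment-right path by a right arc. -/
theorem threeArc_of_right_shrink {z v : ℂ} {η ζ d L : ℝ} (hζη : ζ ≤ η) (hη : η < Real.pi)
    (hζ : 0 ≤ ζ) (hd : 0 < d)
    (hv : v = cis (-(η + ζ))) (hz : z = Complex.I * (v - 1) + d * cis (-η))
    (hL : η + ζ + d < L) (hL' : (L - η - ζ) * Real.sinc ζ ≤ d) : ThreeArc z v L := by
  obtain ⟨δ, ⟨h0, hδζ⟩, hδ⟩ := intermediate_value_Icc' (f := fun δ => (L - η - ζ) * Real.sinc δ) hζ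
    (continuous_const.mul Real.continuous_sinc).continuousOn
    (show d ∈ Icc _ _ from ⟨hL', by simp; linarith⟩)
  have hδ0 : 0 < δ := by
    refine h0.lt_of_ne ?_
    rintro rfl
    simp at hδ
    linarith
  have hs : 0 < Real.sin δ := Real.sin_pos_of_pos_of_lt_pi hδ0 (by linarith)
  have hq : d / (2 * Real.sin δ) * (2 * Real.sin δ) = d := div_mul_cancel₀ _ (by positivity)
  have hqp : 0 < d / (2 * Real.sin δ) := by positivity
  -- Both outer arcs give up the angle `δ` to the middle arc, which turns the same way; `d > 0`
  -- makes its radius differ from one.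
  refine ⟨-1, -(η - δ), -1, -(ζ - δ), (IsArc.pos le_rfl (by linarith) (by linarith)).neg,
    (IsArc.pos le_rfl (by linarith) (by linarith)).neg,
    Or.inl ⟨-(1 + d / (2 * Real.sin δ)), -(2 * δ),
      (IsArc.pos (by linarith) (by positivity) (by linarith)).neg, by linarith, by linarith,
      ?_, ?_, ?_⟩⟩
  · rw [hv]; congr 1; ring
  · have e1 : -(η - δ) = -η + δ := by ring
    have e : -η + δ + -(2 * δ) = -η - δ := by ring
    have h := cis_isosceles (-η) δ
    have hq' : ((d / (2 * Real.sin δ) : ℝ) : ℂ) * (2 * Real.sin δ : ℝ) = d := by exact_mod_cast hq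
    rw [hz, e1, e, ← hq']
    push_cast at h ⊢
    linear_combination (((d : ℂ) / (2 * Complex.sin δ))) * h
  · have h1 := mul_sinc δ
    have : L - η - ζ = 2 * δ * (d / (2 * Real.sin δ)) := by
      rw [← hδ, ← h1]
      have := (sinc_pos hδ0.le (by linarith)).ne'
      field_simp
    linear_combination this

/-! ### Right-right-left paths: both arcs below a half turn, distant left circles -/

section

theorem arg_mul_cis {r θ : ℝ} (hr : 0 < r) (h : -Real.pi < θ) (h' : θ ≤ Real.pi) :
    Complex.arg (r * cis θ) = θ := by
  rw [cis, Complex.exp_mul_I]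
  exact Complex.arg_mul_cos_add_sin_mul_I hr ⟨h, h'⟩

theorem norm_mul_cis_arg (z : ℂ) : (‖z‖ : ℂ) * cis z.arg = z := Complex.norm_mul_exp_arg_mul_I z

theorem norm_mul_sin_arg_sub (z : ℂ) (φ : ℝ) :
    ‖z‖ * Real.sin (z.arg - φ) = (z * cis (-φ)).im := by
  conv_rhs => rw [← norm_mul_cis_arg z, mul_assoc, ← cis_add, ← sub_eq_add_neg]
  rw [Complex.im_ofReal_mul, cis_im]

/-- The (reflected) vector from the centre of the left circle at the start to the centre of the
left circle at the end, for a path that first runs right by the angle `x`, then a segment of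
length `d`, and then right by the angle `s`. -/
def bend (d s x : ℝ) : ℂ := d * cis x + 2 * Complex.I * (1 - cis (x + s))

theorem bend_re (d s x : ℝ) : (bend d s x).re = d * Real.cos x + 2 * Real.sin (x + s) := by
  simp [bend, cis_re, cis_im]

theorem bend_im (d s x : ℝ) : (bend d s x).im = d * Real.sin x + 2 * (1 - Real.cos (x + s)) := by
  simp [bend, cis_re, cis_im]

theorem continuous_cis : Continuous cis := by unfold cis; fun_prop

theorem continuous_bend (d s : ℝ) : Continuous (bend d s) := by
  have := continuous_cis
  unfold bend
  fun_prop

theorem conj_bend (d s x : ℝ) : (starRingEnd ℂ) (bend d s x)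
    = d * cis (-x) - 2 * Complex.I * (1 - cis (-(x + s))) := by
  simp only [bend, map_add, map_mul, map_sub, map_one, conj_cis, Complex.conj_ofReal,
    Complex.conj_I, map_ofNat]
  ring

variable {d s x η y L : ℝ} {z v : ℂ}

theorem bend_im_pos (hd : 0 ≤ d) (hs : 0 ≤ s) (hsx : s ≤ x) (hx₀ : 0 < x) (hx : x < Real.pi) :
    0 < (bend d s x).im := by
  rw [bend_im]
  have h1 := Real.sin_pos_of_pos_of_lt_pi hx₀ hx
  have h2 : 0 < Real.sin ((x + s) / 2) :=
    Real.sin_pos_of_pos_of_lt_pi (by linarith) (by linarith)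
  have h3 : Real.cos (x + s) = 1 - 2 * Real.sin ((x + s) / 2) ^ 2 := by
    have := Real.cos_sq ((x + s) / 2)
    have e : 2 * ((x + s) / 2) = x + s := by ring
    rw [e] at this
    have := Real.sin_sq_add_cos_sq ((x + s) / 2)
    linarith
  rw [h3]
  nlinarith [mul_nonneg hd h1.le, pow_pos h2 2]

/-- Exhibits the vector as a combination of the directions `x` and `(x + s) / 2`, with nonnegative
coefficients in the range used; hence the bounds on its argument. -/
theorem bend_eq (d s x : ℝ) : bend d s x
    = d * cis x + (4 * Real.sin ((x + s) / 2) : ℝ) * cis ((x + s) / 2) := by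
  have h := cis_isosceles ((x + s) / 2) ((x + s) / 2)
  rw [add_halves, sub_self, cis_zero] at h
  rw [bend]
  push_cast at h ⊢
  linear_combination (-2) * h

theorem norm_bend_mul_sin (d s x φ : ℝ) : ‖bend d s x‖ * Real.sin ((bend d s x).arg - φ)
    = d * Real.sin (x - φ) + 4 * Real.sin ((x + s) / 2) * Real.sin ((x + s) / 2 - φ) := by
  rw [norm_mul_sin_arg_sub, bend_eq, add_mul, mul_assoc, mul_assoc, ← cis_add, ← cis_add,
    Complex.add_im, Complex.im_ofReal_mul, Complex.im_ofReal_mul, cis_im, cis_im,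
    ← sub_eq_add_neg, ← sub_eq_add_neg]

theorem arg_bend (hd : 0 ≤ d) (hs : 0 ≤ s) (hsx : s ≤ x) (hx : x < Real.pi) :
    (x + s) / 2 ≤ (bend d s x).arg ∧ (bend d s x).arg ≤ x := by
  rcases (hs.trans hsx).eq_or_lt with rfl | hx₀
  · obtain rfl : s = 0 := le_antisymm hsx hs
    simp [bend, cis_zero, Complex.arg_ofReal_of_nonneg hd]
  have him := bend_im_pos hd hs hsx hx₀ hx
  set Z := bend d s x with hZ
  have hn : 0 < ‖Z‖ := norm_pos_iff.2 fun h => by simp [h] at him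
  have h0 : 0 < Z.arg := lt_of_le_of_ne (Complex.arg_nonneg_iff.2 him.le) fun h => by
    have := Complex.norm_mul_sin_arg Z
    rw [← h] at this
    simp at this
    linarith
  have hπ : Z.arg < Real.pi := Complex.arg_lt_pi_iff.2 (Or.inr him.ne')
  have hdiff : 0 ≤ Real.sin ((x - s) / 2) :=
    Real.sin_nonneg_of_nonneg_of_le_pi (by linarith) (by linarith)
  have hsum : 0 ≤ Real.sin ((x + s) / 2) :=
    Real.sin_nonneg_of_nonneg_of_le_pi (by linarith) (by linarith)
  have h1 := norm_bend_mul_sin d s x ((x + s) / 2)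
  have h2 := norm_bend_mul_sin d s x x
  have e1 : x - (x + s) / 2 = (x - s) / 2 := by ring
  have e2 : (x + s) / 2 - x = -((x - s) / 2) := by ring
  rw [← hZ, e1, sub_self ((x + s) / 2), Real.sin_zero, mul_zero, add_zero] at h1
  rw [← hZ, e2, sub_self x, Real.sin_zero, mul_zero, zero_add, Real.sin_neg] at h2
  constructor
  · by_contra! hlt
    have := Real.sin_neg_of_neg_of_neg_pi_lt (x := Z.arg - (x + s) / 2) (by linarith) (by linarith)
    nlinarith [mul_nonneg hd hdiff]
  · by_contra! hlt
    have := Real.sin_pos_of_pos_of_lt_pi (x := Z.arg - x) (by linarith) (by linarith)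
    nlinarith [mul_nonneg hsum hdiff]

/-- Equivalent to `2 < ‖bend d s x - 2 * I‖`: the unit right circle at the start and the unit left
circle at the end are disjoint. It is the condition for the middle radius of the right-right-left
path to exceed one. -/
theorem four_mul_bend_im_lt (hd : 0 < d) (hs : 0 ≤ s) (hs' : s < Real.pi) :
    4 * (bend d s x).im < ‖bend d s x‖ ^ 2 := by
  rw [← Complex.normSq_eq_norm_sq, Complex.normSq_apply, bend_re, bend_im]
  have h1 := Real.sin_nonneg_of_nonneg_of_le_pi hs hs'.le
  have h2 := Real.sin_sq_add_cos_sq x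
  have h3 := Real.sin_sq_add_cos_sq (x + s)
  have h4 : Real.sin s = Real.sin (x + s) * Real.cos x - Real.cos (x + s) * Real.sin x := by
    rw [← Real.sin_sub]; congr 1; ring
  have : (d * Real.cos x + 2 * Real.sin (x + s)) * (d * Real.cos x + 2 * Real.sin (x + s)) +
      (d * Real.sin x + 2 * (1 - Real.cos (x + s))) * (d * Real.sin x + 2 * (1 - Real.cos (x + s)))
      - 4 * (d * Real.sin x + 2 * (1 - Real.cos (x + s))) = d ^ 2 + 4 * d * Real.sin s := by
    rw [h4]
    linear_combination d ^ 2 * h2 + 4 * h3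
  have := mul_nonneg hd.le h1
  have := pow_pos hd 2
  linarith

/-- Right arc of radius one, right arc of larger radius, left arc of radius one. -/
theorem threeArc_of_right_right_left (hd : 0 < d) (hs : 0 ≤ s) (hsx : s ≤ x) (hx₀ : 0 < x)
    (hxη : x ≤ η) (hη : η < Real.pi) (hy : 0 ≤ y) (hy' : y ≤ Real.pi)
    (hv : v = cis (y - η - s))
    (hz : z = Complex.I * (-1 - v) + cis (-η) * (2 * Complex.I * cis (-s) + d))
    (hL : L = η - 2 * x - s + y + ‖bend d s x‖ / Real.sinc (bend d s x).arg) :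
    ThreeArc z v L := by
  have hxπ : x < Real.pi := hxη.trans_lt hη
  obtain ⟨ha1, ha2⟩ := arg_bend hd.le hs hsx hxπ
  have him := bend_im_pos hd.le hs hsx hx₀ hxπ
  have h4 := four_mul_bend_im_lt (x := x) hd hs (hsx.trans_lt hxπ)
  have hconj := conj_bend d s x
  rw [← norm_mul_cis_arg (bend d s x), map_mul, conj_cis, Complex.conj_ofReal] at hconj
  rw [← Complex.norm_mul_sin_arg] at h4 him
  set ω := (bend d s x).arg with hω
  set n := ‖bend d s x‖ with hn
  have hω0 : 0 < ω := by linarith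
  have hsin : 0 < Real.sin ω := Real.sin_pos_of_pos_of_lt_pi hω0 (by linarith)
  have hn0 : 0 < n := by
    by_contra! h
    nlinarith
  have hq : n / (2 * Real.sin ω) * (2 * Real.sin ω) = n := div_mul_cancel₀ _ (by positivity)
  have hp : 1 < n / (2 * Real.sin ω) - 1 := by
    rw [lt_sub_iff_add_lt, lt_div_iff₀ (by positivity)]
    nlinarith
  -- A right arc of radius `p` and turn `2ω` followed by a unit left arc moves the left centre by a
  -- chord of length `2 (p + 1) sin ω` in the direction turned right by `ω`. So the argument and
  -- norm of `bend` determine `ω` and `p`.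
  refine ⟨-1, -(η - x), 1, 2 * ω - x - s + y,
    (IsArc.pos le_rfl (by linarith) (by linarith)).neg,
    IsArc.pos le_rfl (by linarith) (by linarith),
    Or.inl ⟨-(n / (2 * Real.sin ω) - 1), -(2 * ω),
      (IsArc.pos hp.le (by linarith) (by linarith)).neg, by linarith, by linarith, ?_, ?_, ?_⟩⟩
  · rw [hv]; congr 1; ring
  · have h := cis_chord ω
    have hq' : ((n / (2 * Real.sin ω) : ℝ) : ℂ) * (2 * Real.sin ω : ℝ) = n := by exact_mod_cast hq
    rw [← hq'] at hconj
    have e1 : -(η - x) = -η + x := by ring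
    have e2 : cis (-(x + s)) = cis (-x) * cis (-s) := by rw [← cis_add]; congr 1; ring
    have e3 := cis_mul_cis_neg x
    rw [e2] at hconj
    rw [hz, e1, cis_add (-η + x), cis_add (-η)]
    push_cast at h hconj ⊢
    generalize (n : ℂ) / (2 * Complex.sin ω) = q at *
    linear_combination (-(cis (-η) * cis x)) * hconj - (q * cis (-η) * cis x) * h
      - (cis (-η) * (d + 2 * Complex.I * cis (-s))) * e3
  · have h1 := mul_sinc ω
    have hsc := (sinc_pos hω0.le (by linarith)).ne'
    have : n / Real.sinc ω = 2 * ω * (n / (2 * Real.sin ω)) := by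
      rw [← h1]
      field_simp
    rw [hL, this]
    ring

theorem bend_mem_slitPlane (hd : 0 < d) (hs : 0 ≤ s) (hsx : s ≤ x) (hx : x < Real.pi) :
    bend d s x ∈ Complex.slitPlane := by
  rcases (hs.trans hsx).eq_or_lt with rfl | hx₀
  · obtain rfl : s = 0 := le_antisymm hsx hs
    left
    simpa [bend_re] using hd
  · exact Or.inr (bend_im_pos hd.le hs hsx hx₀ hx).ne'

/-- All lengths from that of `bend` at `s` on, provided the left circles at both ends are far
apart. -/
theorem threeArc_of_bend (hd : 0 ≤ d) (hs : 0 ≤ s) (hsη : s ≤ η) (hη : η < Real.pi)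
    (hy : 0 ≤ y) (hy' : y ≤ Real.pi) (hv : v = cis (y - η - s))
    (hz : z = Complex.I * (-1 - v) + cis (-η) * (2 * Complex.I * cis (-s) + d))
    (hD : 4 ≤ ‖z - Complex.I * (1 - v)‖)
    (hL : η + s + y + d < L) (hL' : η + s + y + d / Real.sinc s ≤ L) : ThreeArc z v L := by
  have hzb : z = Complex.I * (1 - v) + (starRingEnd ℂ) (bend d s η) := by
    have e2 : cis (-(η + s)) = cis (-η) * cis (-s) := by rw [← cis_add]; congr 1; ring
    rw [hz, conj_bend, e2]
    ring
  have hDn : ‖z - Complex.I * (1 - v)‖ = ‖bend d s η‖ := by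
    rw [hzb, add_sub_cancel_left, RCLike.norm_conj]
  rw [hDn] at hD
  obtain ⟨ha1, ha2⟩ := arg_bend hd hs hsη hη
  have hsc : 0 < Real.sinc (bend d s η).arg := sinc_pos (by linarith) (by linarith)
  -- At `x = η` the initial right arc has vanished; longer paths begin with a left arc instead, and
  -- the left-right-left stage takes over.
  by_cases hend : η - 2 * η - s + y + ‖bend d s η‖ / Real.sinc (bend d s η).arg ≤ L
  · refine threeArc_of_isosceles_le (δ₀ := (bend d s η).arg) (X := -(bend d s η).arg)
      (Y := (bend d s η).arg - η - s + y) (D := ‖bend d s η‖) (by linarith) (by linarith)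
      (by linarith) (by linarith) (by linarith) (by linarith) (by linarith) ?_ ?_ ?_ ?_ ?_
    · intro δ _ _
      linarith [Real.sin_le_one δ]
    · rcases (hs.trans hsη).eq_or_lt with rfl | hη₀
      · right
        obtain rfl : s = 0 := le_antisymm hsη hs
        have : ‖bend d 0 0‖ = d := by simp [bend, cis_zero, abs_of_nonneg hd]
        linarith
      · left
        linarith
    · rw [← div_le_iff₀ hsc]
      linarith
    · rw [hv]; congr 1; ring
    · rw [hzb, ← norm_mul_cis_arg (bend d s η), map_mul, conj_cis, Complex.conj_ofReal,
        norm_mul_cis_arg]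
  · push Not at hend
    -- For `d = 0` the length at `x = η` is already `η + s + y`, below `L`, so this branch cannot
    -- occur.
    have hd0 : 0 < d := by
      refine hd.lt_of_ne ?_
      rintro rfl
      have hb : bend 0 s η = (4 * Real.sin ((η + s) / 2) : ℝ) * cis ((η + s) / 2) := by
        simp [bend_eq]
      have hpos : 0 < 4 * Real.sin ((η + s) / 2) := by
        have := Real.sin_nonneg_of_nonneg_of_le_pi (x := (η + s) / 2) (by linarith) (by linarith)
        refine lt_of_le_of_ne (by linarith) fun h => ?_
        rw [← h] at hb
        norm_num [hb] at hD
      have harg := arg_mul_cis hpos (θ := (η + s) / 2) (by linarith) (by linarith)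
      rw [← hb] at harg
      have hnorm : ‖bend 0 s η‖ = 4 * Real.sin ((η + s) / 2) := by
        rw [hb, norm_mul, norm_cis, mul_one, Complex.norm_real, Real.norm_of_nonneg hpos.le]
      rw [harg] at hend hsc
      rw [hnorm, ← mul_sinc, mul_comm _ (Real.sinc _), ← mul_assoc, mul_div_right_comm,
        mul_div_assoc, div_self hsc.ne'] at hend
      linarith
    have hcont : ContinuousOn (fun x => η - 2 * x - s + y
        + ‖bend d s x‖ / Real.sinc (bend d s x).arg) (Icc s η) := by
      intro x hx
      have hxπ : x < Real.pi := hx.2.trans_lt hη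
      have hb := (continuous_bend d s).continuousAt (x := x)
      have harg : ContinuousAt (fun x => (bend d s x).arg) x :=
        (Complex.continuousAt_arg (bend_mem_slitPlane hd0 hs hx.1 hxπ)).comp hb
      obtain ⟨h1, h2⟩ := arg_bend hd hs hx.1 hxπ
      have hne : Real.sinc (bend d s x).arg ≠ 0 :=
        (sinc_pos (by linarith [hx.1]) (by linarith)).ne'
      refine ContinuousAt.continuousWithinAt (ContinuousAt.add (by fun_prop) ?_)
      exact hb.norm.div (Real.continuous_sinc.continuousAt.comp harg) hne
    -- At `x = s` both summands of `bend_eq` point in the direction `s`, so the length there is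
    -- exactly `η + s + y + d / sinc s`.
    have hstart : η - 2 * s - s + y + ‖bend d s s‖ / Real.sinc (bend d s s).arg ≤ L := by
      have hsc' : 0 < Real.sinc s := sinc_pos hs (by linarith)
      have hsin := Real.sin_nonneg_of_nonneg_of_le_pi hs (by linarith)
      have hpos : 0 < d + 4 * Real.sin s := by linarith
      have hb : bend d s s = (d + 4 * Real.sin s : ℝ) * cis s := by
        have e : (s + s) / 2 = s := by ring
        rw [bend_eq, e]
        push_cast
        ring
      have harg := arg_mul_cis hpos (θ := s) (by linarith) (by linarith)
      have hnorm : ‖bend d s s‖ = d + 4 * Real.sin s := by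
        rw [hb, norm_mul, norm_cis, mul_one, Complex.norm_real, Real.norm_of_nonneg hpos.le]
      rw [hnorm, hb, harg, add_div, ← mul_sinc s, ← mul_assoc, mul_div_assoc, div_self hsc'.ne']
      linarith
    obtain ⟨x, hx, hxL⟩ := intermediate_value_Icc hsη hcont
      (show L ∈ Icc _ _ from ⟨hstart, hend.le⟩)
    have hx₀ : 0 < x := by
      refine (hs.trans hx.1).lt_of_ne ?_
      rintro rfl
      obtain rfl : s = 0 := le_antisymm hx.1 hs
      have h0 : bend d 0 0 = d := by simp [bend, cis_zero]
      simp [h0, Complex.arg_ofReal_of_nonneg hd, abs_of_nonneg hd] at hxL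
      linarith
    exact threeArc_of_right_right_left hd0 hs hx.1 hx₀ hx.2 hη hy hy' hv hz hxL.symm

end

/-! ### First arc of at least a half turn: widening it -/

section

theorem sin_two_mul_arctan (T : ℝ) : Real.sin (2 * Real.arctan T) = 2 * T / (1 + T ^ 2) := by
  have h : 0 < 1 + T ^ 2 := by positivity
  rw [Real.sin_two_mul, Real.sin_arctan, Real.cos_arctan]
  field_simp
  rw [Real.sq_sqrt h.le]

theorem cos_two_mul_arctan (T : ℝ) :
    Real.cos (2 * Real.arctan T) = (1 - T ^ 2) / (1 + T ^ 2) := by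
  have h : 0 < 1 + T ^ 2 := by positivity
  rw [Real.cos_two_mul, Real.cos_sq_arctan]
  field_simp
  ring

theorem arctan_lt_of_mul_cos_lt {T φ : ℝ} (hφ : 0 < φ) (hφ' : φ ≤ Real.pi / 2)
    (h : T * Real.cos φ < Real.sin φ) : Real.arctan T < φ := by
  rcases hφ'.eq_or_lt with rfl | hlt
  · exact Real.arctan_lt_pi_div_two T
  · have hc : 0 < Real.cos φ := Real.cos_pos_of_mem_Ioo ⟨by linarith, hlt⟩
    rw [← Real.arctan_tan (by linarith) hlt, Real.arctan_lt_arctan_iff, Real.tan_eq_sin_div_cos,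
      lt_div_iff₀ hc]
    exact h

variable {r₀ η ζ d R N L : ℝ} {z v : ℂ}

/-- Keeps the widened first arc below a full turn. In terms of `η / 2` the claim compares `arctan`
with `π - η / 2`, and the margin comes from `d sin (η / 2) > 0`. Since `N` is only bounded below,
both widening constructions are covered. -/
theorem add_two_mul_arctan_lt (hη : Real.pi ≤ η) (hη' : η < 2 * Real.pi) (hR : 0 ≤ R)
    (hd : 0 < d) (hN : d - R * Real.sin η ≤ N) :
    η + 2 * Real.arctan (R * (1 - Real.cos η) / N) < 2 * Real.pi := by
  have hs : 0 < Real.sin (η / 2) :=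
    Real.sin_pos_of_pos_of_lt_pi (by linarith [Real.pi_pos]) (by linarith)
  have h1 : Real.sin η = 2 * Real.sin (η / 2) * Real.cos (η / 2) := by
    rw [← Real.sin_two_mul]; congr 1; ring
  have h2 : Real.cos η = 1 - 2 * Real.sin (η / 2) ^ 2 := by
    have := Real.cos_two_mul (η / 2)
    rw [mul_div_cancel₀ _ two_ne_zero] at this
    linarith [Real.sin_sq_add_cos_sq (η / 2)]
  have hc : Real.cos (η / 2) ≤ 0 :=
    Real.cos_nonpos_of_pi_div_two_le_of_le (by linarith) (by linarith)
  have hN0 : 0 < N := by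
    rw [h1] at hN
    nlinarith [mul_nonneg hR (mul_nonneg hs.le (neg_nonneg.2 hc))]
  have := arctan_lt_of_mul_cos_lt (T := R * (1 - Real.cos η) / N) (φ := Real.pi - η / 2)
    (by linarith) (by linarith) (by
      rw [Real.cos_pi_sub, Real.sin_pi_sub, div_mul_eq_mul_div, div_lt_iff₀ hN0, h2]
      rw [h1] at hN
      nlinarith [mul_le_mul_of_nonneg_left hN hs.le, mul_pos hs hd])
  linarith

theorem one_sub_cos_pos (hη : Real.pi ≤ η) (hη' : η < 2 * Real.pi) : 0 < 1 - Real.cos η := by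
  have hs : 0 < Real.sin (η / 2) :=
    Real.sin_pos_of_pos_of_lt_pi (by linarith [Real.pi_pos]) (by linarith)
  have := Real.cos_two_mul (η / 2)
  rw [mul_div_cancel₀ _ two_ne_zero] at this
  nlinarith [Real.sin_sq_add_cos_sq (η / 2), pow_pos hs 2]

theorem neg_sin_nonneg (hη : Real.pi ≤ η) (hη' : η < 2 * Real.pi) : 0 ≤ -Real.sin η := by
  rw [← Real.sin_sub_pi]
  exact Real.sin_nonneg_of_nonneg_of_le_pi (by linarith) (by linarith)

/-- Replacing an arc of radius `r` followed by a segment of length `d` by an arc of radius `r + R`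
followed by an arc turning the other way by the angle `w`: the sum `Q` of the new radii, less
`r`. -/
theorem biarc_identity {w Q : ℝ} (hR : 0 < R) (hd : 0 < d) (hη : Real.pi ≤ η)
    (hη' : η < 2 * Real.pi)
    (hw : w = 2 * Real.arctan (R * (1 - Real.cos η) / (d - R * Real.sin η)))
    (hQ : Q = (d ^ 2 - 2 * d * R * Real.sin η) / (2 * R * (1 - Real.cos η)) + R) :
    Q * Real.sin w = d - R * Real.sin η ∧
      (Q : ℂ) * cis (-w) = R * cis η + (Q - R) - Complex.I * d := by
  have hk := one_sub_cos_pos hη hη'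
  have hs := neg_sin_nonneg hη hη'
  have hN : 0 < d - R * Real.sin η := by nlinarith [mul_nonneg hR.le hs]
  have hcs := Real.sin_sq_add_cos_sq η
  have hsin : Q * Real.sin w = d - R * Real.sin η := by
    rw [hw, sin_two_mul_arctan, hQ]
    field_simp
    linear_combination (-R ^ 2) * hcs
  have hcos : Q * Real.cos w = R * Real.cos η + (Q - R) := by
    rw [hw, cos_two_mul_arctan, hQ]
    field_simp
    linear_combination (2 * R ^ 4 * (1 - Real.cos η) ^ 2) * hcs
  refine ⟨hsin, Complex.ext ?_ ?_⟩
  · simpa [cis_re, cis_im] using hcos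
  · simp [cis_re, cis_im]
    linarith

/-- Right arc of at least a half turn, segment, left arc of radius one. -/
theorem threeArc_of_right_line_left (hr₀ : 1 ≤ r₀) (hη : Real.pi ≤ η) (hη' : η < 2 * Real.pi)
    (hd : 0 ≤ d) (hζ : 0 ≤ ζ) (hζ' : ζ < 2 * Real.pi) (hv : v = cis (ζ - η))
    (hz : z = Complex.I * (1 - v) + Complex.I * (r₀ + 1) * (cis (-η) - 1) + d * cis (-η))
    (hL : r₀ * η + d + ζ < L) : ThreeArc z v L := by
  have hπ := Real.pi_pos
  rcases hd.eq_or_lt with rfl | hd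
  · exact threeArc_of_right_left hr₀ hη hη' hζ (by linarith) hv (by simpa using hz) (by linarith)
  have hk := one_sub_cos_pos hη hη'
  have hs := neg_sin_nonneg hη hη'
  set w : ℝ → ℝ := fun R => 2 * Real.arctan (R * (1 - Real.cos η) / (d - R * Real.sin η)) with hw
  set Q : ℝ → ℝ := fun R =>
    (d ^ 2 - 2 * d * R * Real.sin η) / (2 * R * (1 - Real.cos η)) + R with hQ
  have hN : ∀ R, 0 ≤ R → 0 < d - R * Real.sin η := fun R hR => by nlinarith [mul_nonneg hR hs]
  have hw0 : ∀ R, 0 ≤ R → 0 ≤ w R := fun R hR =>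
    mul_nonneg two_pos.le (Real.arctan_nonneg.2 (div_nonneg (mul_nonneg hR hk.le) (hN R hR).le))
  have hwlt : ∀ R, 0 ≤ R → η + w R < 2 * Real.pi := fun R hR =>
    add_two_mul_arctan_lt hη hη' hR hd le_rfl
  have hsc : ∀ R, 0 ≤ R → 0 < Real.sinc (w R) := fun R hR =>
    sinc_pos (hw0 R hR) (by linarith [hwlt R hR])
  -- The length of the deformed path. The term `Q R * w R` is rewritten as a quotient that stays
  -- continuous at `R = 0`, where `Q` has a zero denominator.
  set G : ℝ → ℝ := fun R => r₀ * η + ζ + R * η + (d - R * Real.sin η) / Real.sinc (w R) with hG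
  have hG0 : G 0 < L := by simp [hG, hw]; linarith
  have hGc : ∀ b, ContinuousOn G (Icc 0 b) := by
    intro b R hR
    have hwc : ContinuousAt w R :=
      continuousAt_const.mul (Real.continuous_arctan.continuousAt.comp
        (ContinuousAt.div (by fun_prop) (by fun_prop) (hN R hR.1).ne'))
    refine ContinuousAt.continuousWithinAt (ContinuousAt.add (by fun_prop) ?_)
    exact ContinuousAt.div (by fun_prop) (Real.continuous_sinc.continuousAt.comp hwc)
      (hsc R hR.1).ne'
  have hQG : ∀ R, 0 < R → r₀ * η + ζ + R * η + Q R * w R = G R := by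
    intro R hR
    obtain ⟨h1, -⟩ := biarc_identity (w := w R) (Q := Q R) hR hd hη hη' rfl rfl
    have hne := (hsc R hR.le).ne'
    simp only [hG]
    rw [← h1, ← mul_sinc (w R)]
    field_simp
  have hcc : cis η * cis (-η) = 1 := cis_mul_cis_neg η
  -- The strict bound on the middle radius keeps the middle circle distinct from the final left
  -- circle of radius one.
  have good : ∀ R, 0 < R → 1 < Q R - R - r₀ → G R = L → ThreeArc z v L := by
    intro R hR hP hRL
    obtain ⟨-, h2⟩ := biarc_identity (w := w R) (Q := Q R) hR hd hη hη' rfl rfl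
    have h3 := hQG R hR
    refine ⟨-(r₀ + R), -(η + w R), 1, ζ,
      (IsArc.pos (by linarith) (by linarith [hw0 R hR.le]) (hwlt R hR.le)).neg,
      .pos le_rfl hζ hζ', Or.inl ⟨Q R - R - r₀, w R,
        .pos hP.le (hw0 R hR.le) (by linarith [hwlt R hR.le]), by linarith, by linarith,
        ?_, ?_, ?_⟩⟩
    · rw [hv]; congr 1; ring
    · have e1 : -(η + w R) = -η + -w R := by ring
      have e2 : -(η + w R) + w R = -η := by ring
      rw [hz, e2, e1, cis_add]
      push_cast
      linear_combination (-Complex.I * cis (-η)) * h2 - (Complex.I * R) * hcc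
        + (d * cis (-η)) * Complex.I_mul_I
    · rw [← hRL, ← h3]; ring
  have cond : ∀ R, 0 < R → 2 * R * (1 - Real.cos η) * (r₀ + 1)
      < d ^ 2 - 2 * d * R * Real.sin η → 1 < Q R - R - r₀ := by
    intro R hR h
    have : r₀ + 1 < (d ^ 2 - 2 * d * R * Real.sin η) / (2 * R * (1 - Real.cos η)) := by
      rw [lt_div_iff₀ (by positivity)]
      linarith
    simp only [hQ]
    linarith
  have pos_of_eq : ∀ R, 0 ≤ R → G R = L → 0 < R := by
    intro R hR h
    refine hR.lt_of_ne ?_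
    rintro rfl
    exact hG0.ne h
  -- The middle radius exceeds one as long as `R * K < d ^ 2`, with `K` as below. In this case `K ≤
  -- 0`, so every `R > 0` is admissible and the length is unbounded.
  by_cases hcase : (1 - Real.cos η) * (r₀ + 1) ≤ -(d * Real.sin η)
  · have hη0 : 0 < η := by linarith
    have hL0 : 0 < L := by
      have := mul_pos (lt_of_lt_of_le one_pos hr₀) hη0
      linarith
    have hb : 0 ≤ L / η := by positivity
    have hGb : L ≤ G (L / η) := by
      have h1 : L / η * η = L := div_mul_cancel₀ _ hη0.ne'
      have h2 := div_pos (hN _ hb) (hsc _ hb)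
      have h3 := mul_pos (lt_of_lt_of_le one_pos hr₀) hη0
      simp only [hG]
      linarith
    obtain ⟨R, hR, hRL⟩ := intermediate_value_Icc hb (hGc _) (show L ∈ Icc _ _ from ⟨hG0.le, hGb⟩)
    have hR0 := pos_of_eq R hR.1 hRL
    refine good R hR0 (cond R hR0 ?_) hRL
    nlinarith [pow_pos hd 2]
  · push Not at hcase
    set K := 2 * ((1 - Real.cos η) * (r₀ + 1) + d * Real.sin η) with hK
    have hK0 : 0 < K := by rw [hK]; linarith
    have hR₁ : 0 < d ^ 2 / K := by positivity
    have hR₁K : d ^ 2 / K * K = d ^ 2 := div_mul_cancel₀ _ hK0.ne'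
    -- At `R = d ^ 2 / K` the middle arc has radius one and merges with the last arc into a
    -- right-left path, which is elongated further.
    have junction : G (d ^ 2 / K) ≤ L → ThreeArc z v L := by
      intro hGL
      generalize d ^ 2 / K = R at *
      obtain ⟨-, h2⟩ := biarc_identity (w := w R) (Q := Q R) hR₁ hd hη hη' rfl rfl
      have h3 := hQG R hR₁
      have hQR : Q R = r₀ + R + 1 := by
        have : (d ^ 2 - 2 * d * R * Real.sin η) / (2 * R * (1 - Real.cos η)) = r₀ + 1 := by
          rw [div_eq_iff (by positivity), ← hR₁K, hK]
          ring
        simp only [hQ, this]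
        ring
      refine threeArc_of_right_left (r := r₀ + R) (φ := η + w R) (y := ζ + w R) (by linarith)
        (by linarith [hw0 R hR₁.le]) (hwlt R hR₁.le) (by linarith [hw0 R hR₁.le])
        (by linarith [hwlt R hR₁.le]) ?_ ?_ ?_
      · rw [hv]; congr 1; ring
      · have e1 : -(η + w R) = -η + -w R := by ring
        rw [hz, e1, cis_add]
        rw [hQR] at h2
        push_cast at h2 ⊢
        linear_combination (-Complex.I * cis (-η)) * h2 - (Complex.I * R) * hcc
          + (d * cis (-η)) * Complex.I_mul_I
      · rw [hQR] at h3
        linarith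
    by_cases hGL : G (d ^ 2 / K) ≤ L
    · exact junction hGL
    · push Not at hGL
      obtain ⟨R, hR, hRL⟩ := intermediate_value_Icc hR₁.le (hGc _)
        (show L ∈ Icc _ _ from ⟨hG0.le, hGL.le⟩)
      have hR0 := pos_of_eq R hR.1 hRL
      have hlt : R < d ^ 2 / K := hR.2.lt_of_ne fun h => hGL.ne' (by rw [← h, hRL])
      refine good R hR0 (cond R hR0 ?_) hRL
      have := mul_lt_mul_of_pos_right hlt hK0
      rw [hR₁K, hK] at this
      linarith

/-- Widening the first arc of a right-segment-right path by `R`: the heading of the segment turns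
by `w`, and its new length is `e`. -/
theorem widen_identity {w e : ℝ} (hR : 0 ≤ R) (hd : 0 < d) (hη : Real.pi ≤ η)
    (hη' : η < 2 * Real.pi) (he : e = √(d ^ 2 - 2 * d * R * Real.sin η))
    (hw : w = 2 * Real.arctan (R * (1 - Real.cos η) / (d - R * Real.sin η + e))) :
    (d : ℂ) = e * cis (-w) - Complex.I * R * (cis η - cis (-w)) := by
  have hs := neg_sin_nonneg hη hη'
  have hN : 0 < d - R * Real.sin η := by nlinarith [mul_nonneg hR hs]
  have hcs := Real.sin_sq_add_cos_sq η
  have he0 : 0 ≤ e := by rw [he]; positivity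
  have he2 : e ^ 2 = d ^ 2 - 2 * d * R * Real.sin η := by
    rw [he, Real.sq_sqrt]
    nlinarith [mul_nonneg (mul_nonneg hd.le hR) hs]
  set T := R * (1 - Real.cos η) / (d - R * Real.sin η + e) with hT
  have hne : d - R * Real.sin η + e ≠ 0 := by positivity
  have hM : T * (d - R * Real.sin η + e) = R * (1 - Real.cos η) := div_mul_cancel₀ _ hne
  -- `T` is the tangent of half the angle `w`. This relation is obtained by cancelling only the
  -- positive denominator of `T`, never `R`, so `R = 0` is included.
  have hquad : e - (d - R * Real.sin η) = -2 * R * T + T ^ 2 * (d - R * Real.sin η + e) := by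
    have h : (d - R * Real.sin η + e) * (e - (d - R * Real.sin η) - (-2 * R * T
        + T ^ 2 * (d - R * Real.sin η + e))) = 0 := by
      have h1 : T ^ 2 * (d - R * Real.sin η + e) ^ 2 = (R * (1 - Real.cos η)) ^ 2 := by
        rw [← hM]; ring
      linear_combination he2 - h1 + 2 * R * hM - R ^ 2 * hcs
    rcases mul_eq_zero.1 h with h | h
    · exact absurd h hne
    · linarith
  have hT2 : (1 + T ^ 2) ≠ 0 := by positivity
  have hre : d = e * Real.cos w + R * (Real.sin η + Real.sin w) := by
    rw [hw, cos_two_mul_arctan, sin_two_mul_arctan]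
    field_simp
    linear_combination -hquad
  have him : 0 = -(e * Real.sin w) - R * (Real.cos η - Real.cos w) := by
    rw [hw, cos_two_mul_arctan, sin_two_mul_arctan]
    field_simp
    linear_combination (1 + T ^ 2) * hM + T * hquad
  apply Complex.ext
  · simp [cis_re, cis_im]
    linarith
  · simp [cis_re, cis_im]
    linarith

end

section

variable {η ζ d L : ℝ} {z v : ℂ}

/-- Right arc of at least a half turn, segment, right arc. -/
theorem threeArc_of_right_line_right (hη : Real.pi ≤ η) (hη' : η < 2 * Real.pi)
    (hd : 0 < d) (hζ : 0 ≤ ζ) (hζ' : ζ < 2 * Real.pi) (hv : v = cis (-(η + ζ)))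
    (hz : z = Complex.I * (v - 1) + d * cis (-η))
    (hL : η + d + ζ < L) : ThreeArc z v L := by
  have hπ := Real.pi_pos
  have hk := one_sub_cos_pos hη hη'
  have hs := neg_sin_nonneg hη hη'
  set e : ℝ → ℝ := fun R => √(d ^ 2 - 2 * d * R * Real.sin η) with he
  set w : ℝ → ℝ := fun R =>
    2 * Real.arctan (R * (1 - Real.cos η) / (d - R * Real.sin η + e R)) with hw
  have he0 : ∀ R, 0 ≤ e R := fun R => Real.sqrt_nonneg _
  have hN : ∀ R, 0 ≤ R → 0 < d - R * Real.sin η + e R := fun R hR => by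
    nlinarith [mul_nonneg hR hs, he0 R]
  have hw0 : ∀ R, 0 ≤ R → 0 ≤ w R := fun R hR =>
    mul_nonneg two_pos.le (Real.arctan_nonneg.2 (div_nonneg (mul_nonneg hR hk.le) (hN R hR).le))
  have hwlt : ∀ R, 0 ≤ R → η + w R < 2 * Real.pi := fun R hR =>
    add_two_mul_arctan_lt hη hη' hR hd (by linarith [he0 R])
  have hwc : ∀ b, ContinuousOn w (Icc 0 b) := by
    intro b R hR
    refine ContinuousAt.continuousWithinAt (continuousAt_const.mul
      (Real.continuous_arctan.continuousAt.comp
        (ContinuousAt.div (by fun_prop) (by fun_prop) (hN R hR.1).ne')))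
  -- Monotonicity ensures that `w R ≤ ζ`, hence a last arc of nonnegative length, up to the first
  -- stage's end.
  have hmono : ∀ R R', 0 ≤ R → R ≤ R' → w R ≤ w R' := by
    intro R R' hR hRR'
    have hR' := hR.trans hRR'
    refine mul_le_mul_of_nonneg_left (Real.arctan_strictMono.monotone ?_) two_pos.le
    rw [div_le_div_iff₀ (hN R hR) (hN R' hR')]
    have h1 : R * e R' ≤ R' * e R := by
      simp only [he]
      rw [← Real.sqrt_sq hR, ← Real.sqrt_sq hR', ← Real.sqrt_mul (sq_nonneg _),
        ← Real.sqrt_mul (sq_nonneg _), Real.sqrt_sq hR, Real.sqrt_sq hR']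
      apply Real.sqrt_le_sqrt
      have a1 : R ^ 2 ≤ R' ^ 2 := by gcongr
      have a2 := mul_nonneg (mul_nonneg (mul_nonneg hR hR') (mul_nonneg hd.le hs))
        (sub_nonneg.2 hRR')
      nlinarith [mul_le_mul_of_nonneg_right a1 (sq_nonneg d)]
    have h2 : R * (d - R' * Real.sin η + e R') ≤ R' * (d - R * Real.sin η + e R) := by
      nlinarith [mul_le_mul_of_nonneg_right hRR' hd.le]
    nlinarith [mul_le_mul_of_nonneg_right h2 hk.le]
  set G : ℝ → ℝ := fun R => η + ζ + R * (η + w R) + e R with hG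
  have hG0 : G 0 < L := by simp [hG, he, Real.sqrt_sq hd.le]; linarith
  have hGc : ∀ b, ContinuousOn G (Icc 0 b) := fun b => by
    have := hwc b
    fun_prop
  have hid : ∀ R, 0 ≤ R → z = Complex.I * (v - 1) + Complex.I * R * (cis (-η) * cis (-w R) - 1)
      + e R * (cis (-η) * cis (-w R)) := by
    intro R hR
    have h1 := widen_identity hR hd hη hη' (e := e R) (w := w R) rfl rfl
    have h2 := cis_mul_cis_neg η
    rw [hz]
    linear_combination cis (-η) * h1 + (-Complex.I * R) * h2
  have good : ∀ R, 0 ≤ R → w R ≤ ζ → G R = L → ThreeArc z v L := by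
    intro R hR hRζ hRL
    refine ⟨-(1 + R), -(η + w R), -1, -(ζ - w R),
      (IsArc.pos (by linarith) (by linarith [hw0 R hR]) (hwlt R hR)).neg,
      (IsArc.pos le_rfl (by linarith) (by linarith [hw0 R hR])).neg,
      Or.inr ⟨e R, he0 R, ?_, ?_, ?_⟩⟩
    · rw [hv]; congr 1; ring
    · have e1 : -(η + w R) = -η + -w R := by ring
      rw [hid R hR, e1, cis_add]
      push_cast
      ring
    · rw [← hRL]; ring
  by_cases hcase : ∃ R, 0 ≤ R ∧ ζ ≤ w R
  · obtain ⟨R₂, hR₂, hζR₂⟩ := hcase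
    obtain ⟨R₁, hR₁, hwR₁⟩ := intermediate_value_Icc hR₂ (hwc _)
      (show ζ ∈ Icc _ _ from ⟨by simp [hw, hζ], hζR₂⟩)
    by_cases hGL : L ≤ G R₁
    · obtain ⟨R, hR, hRL⟩ := intermediate_value_Icc hR₁.1 (hGc _)
        (show L ∈ Icc _ _ from ⟨hG0.le, hGL⟩)
      exact good R hR.1 ((hmono R R₁ hR.1 hR.2).trans_eq hwR₁) hRL
    · push Not at hGL
      have hlt := hwlt R₁ hR₁.1
      rw [hwR₁] at hlt
      -- The last arc has vanished at `R₁`; what remains is a wide right arc and a segment,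
      -- continued with an empty left arc.
      refine threeArc_of_right_line_left (r₀ := 1 + R₁) (η := η + ζ) (d := e R₁) (ζ := 0)
        (by linarith [hR₁.1]) (by linarith) hlt (he0 _) le_rfl (by linarith)
        (by rw [hv, zero_sub]) ?_ ?_
      · have e1 : -(η + ζ) = -η + -ζ := by ring
        rw [hid R₁ hR₁.1, hwR₁, hv, e1, cis_add]
        push_cast
        ring
      · simp only [hG, hwR₁] at hGL
        linarith
  · push Not at hcase
    have hη0 : 0 < η := by linarith
    -- With `R = L / η` the widening term `R * η` alone contributes the length `L`.
    have hb : 0 ≤ L / η := div_nonneg (by linarith) hη0.le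
    have hGb : L ≤ G (L / η) := by
      have h1 : L / η * η = L := div_mul_cancel₀ _ hη0.ne'
      have h2 := mul_nonneg hb (hw0 _ hb)
      simp only [hG]
      linarith [he0 (L / η)]
    obtain ⟨R, hR, hRL⟩ := intermediate_value_Icc hb (hGc _) (show L ∈ Icc _ _ from ⟨hG0.le, hGb⟩)
    exact good R hR.1 (hcase R hR.1).le hRL

/-! ### Arc-segment-arc paths: reduction by symmetry and case analysis -/

/-- The end of the path from the origin with heading `1` that is made of an arc of length `η`, a
segment of length `d` and an arc of length `ζ`, the arcs being of radius one and of turning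
directions `ε₁` and `ε₃`. -/
def cscEnd (ε₁ ε₃ η d ζ : ℝ) : ℂ :=
  Complex.I * (ε₁ * (1 - cis (ε₁ * η)) + ε₃ * (cis (ε₁ * η) - cis (ε₁ * η + ε₃ * ζ)))
    + d * cis (ε₁ * η)

/-- Three arcs realise every length above that of the given arc-segment-arc path. -/
def Elongates (ε₁ ε₃ η d ζ : ℝ) : Prop :=
  ∀ L, η + d + ζ < L → ThreeArc (cscEnd ε₁ ε₃ η d ζ) (cis (ε₁ * η + ε₃ * ζ)) L

/-- The vector from the centre of the left circle at the start to the one at the end. -/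
def leftGap (ε₁ ε₃ η d ζ : ℝ) : ℂ :=
  cscEnd ε₁ ε₃ η d ζ - Complex.I * (1 - cis (ε₁ * η + ε₃ * ζ))

/-- The vector from the centre of the right circle at the start to the one at the end. -/
def rightGap (ε₁ ε₃ η d ζ : ℝ) : ℂ :=
  cscEnd ε₁ ε₃ η d ζ + Complex.I * (1 - cis (ε₁ * η + ε₃ * ζ))

variable {ε₁ ε₃ : ℝ}

theorem conj_cscEnd (ε₁ ε₃ η d ζ : ℝ) :
    (starRingEnd ℂ) (cscEnd ε₁ ε₃ η d ζ) = cscEnd (-ε₁) (-ε₃) η d ζ := by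
  have e1 : -ε₁ * η = -(ε₁ * η) := by ring
  have e2 : -(ε₁ * η) + -ε₃ * ζ = -(ε₁ * η + ε₃ * ζ) := by ring
  simp only [cscEnd, map_add, map_mul, map_sub, map_one, conj_cis, Complex.conj_I,
    Complex.conj_ofReal, e1, e2]
  push_cast
  ring

theorem cis_mul_conj_cscEnd (ε₁ ε₃ η d ζ : ℝ) :
    cis (ε₁ * η + ε₃ * ζ) * (starRingEnd ℂ) (cscEnd ε₁ ε₃ η d ζ) = cscEnd ε₃ ε₁ ζ d η := by
  have a := cis_mul_cis_neg (ε₁ * η)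
  have c := cis_mul_cis_neg (ε₁ * η + ε₃ * ζ)
  have e : cis (ε₃ * ζ) = cis (ε₁ * η + ε₃ * ζ) * cis (-(ε₁ * η)) := by
    rw [← cis_add]; congr 1; ring
  simp only [cscEnd, map_add, map_mul, map_sub, map_one, conj_cis, Complex.conj_I,
    Complex.conj_ofReal]
  rw [add_comm (ε₃ * ζ), e]
  linear_combination (Complex.I * (ε₃ : ℂ)) * c

theorem elongates_neg_iff : Elongates (-ε₁) (-ε₃) η d ζ ↔ Elongates ε₁ ε₃ η d ζ := by
  have e : -ε₁ * η + -ε₃ * ζ = -(ε₁ * η + ε₃ * ζ) := by ring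
  simp only [Elongates, ← conj_cscEnd, e, ← conj_cis, threeArc_conj_iff]

theorem elongates_swap_iff : Elongates ε₃ ε₁ ζ d η ↔ Elongates ε₁ ε₃ η d ζ := by
  have e : ζ + d + η = η + d + ζ := by ring
  simp only [Elongates, ← cis_mul_conj_cscEnd ε₁ ε₃, add_comm (ε₃ * ζ), e,
    threeArc_conj_reverse_iff]

theorem norm_leftGap_neg : ‖leftGap (-ε₁) (-ε₃) η d ζ‖ = ‖rightGap ε₁ ε₃ η d ζ‖ := by
  rw [← RCLike.norm_conj (rightGap ε₁ ε₃ η d ζ)]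
  congr 1
  have e : -ε₁ * η + -ε₃ * ζ = -(ε₁ * η + ε₃ * ζ) := by ring
  simp only [leftGap, rightGap, map_add, map_mul, map_sub, map_one, conj_cis, Complex.conj_I,
    conj_cscEnd, e]
  ring

theorem norm_leftGap_swap : ‖leftGap ε₃ ε₁ ζ d η‖ = ‖leftGap ε₁ ε₃ η d ζ‖ := by
  rw [← RCLike.norm_conj (leftGap ε₁ ε₃ η d ζ), ← one_mul ‖(starRingEnd ℂ) _‖,
    ← norm_cis (ε₁ * η + ε₃ * ζ), ← norm_mul]
  congr 1
  have c := cis_mul_cis_neg (ε₁ * η + ε₃ * ζ)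
  simp only [leftGap, map_mul, map_sub, map_one, conj_cis, Complex.conj_I]
  rw [← cis_mul_conj_cscEnd ε₁ ε₃ η d ζ, add_comm (ε₃ * ζ)]
  linear_combination (Complex.I) * c

/-- Two right arcs without a segment between them form a single arc, which must be below a full turn
to be deformed; `hdeg` provides for this. -/
theorem elongates_of_pi_le_right (hε₃ : ε₃ = 1 ∨ ε₃ = -1) (hη : Real.pi ≤ η)
    (hη' : η < 2 * Real.pi) (hd : 0 ≤ d) (hζ : 0 ≤ ζ) (hζ' : ζ < 2 * Real.pi)
    (hdeg : ε₃ = -1 → d = 0 → η + ζ < 2 * Real.pi) : Elongates (-1) ε₃ η d ζ := by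
  intro L hL
  rcases hε₃ with rfl | rfl
  · refine threeArc_of_right_line_left (r₀ := 1) le_rfl hη hη' hd hζ hζ' (by congr 1; ring) ?_
      (by linarith)
    simp only [cscEnd, neg_one_mul]
    push_cast
    ring
  · have e : -1 * η + -1 * ζ = -(η + ζ) := by ring
    rcases hd.eq_or_lt with rfl | hd
    · refine threeArc_of_right_left (r := 1) (φ := η + ζ) (y := 0) le_rfl (by linarith)
        (hdeg rfl rfl) le_rfl (by linarith) (by congr 1; ring) ?_ (by linarith)
      simp only [cscEnd, e]
      push_cast
      ring
    · refine threeArc_of_right_line_right hη hη' hd hζ hζ' (by rw [e]) ?_ hL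
      simp only [cscEnd, neg_one_mul]
      push_cast
      ring

theorem elongates_of_pi_le (hε₁ : ε₁ = 1 ∨ ε₁ = -1) (hε₃ : ε₃ = 1 ∨ ε₃ = -1) (hη : Real.pi ≤ η)
    (hη' : η < 2 * Real.pi) (hd : 0 ≤ d) (hζ : 0 ≤ ζ) (hζ' : ζ < 2 * Real.pi)
    (hdeg : ε₁ = ε₃ → d = 0 → η + ζ < 2 * Real.pi) : Elongates ε₁ ε₃ η d ζ := by
  rcases hε₁ with rfl | rfl
  · rw [← elongates_neg_iff]
    refine elongates_of_pi_le_right ?_ hη hη' hd hζ hζ' fun h => hdeg (by linarith)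
    rcases hε₃ with rfl | rfl <;> simp
  · exact elongates_of_pi_le_right hε₃ hη hη' hd hζ hζ' fun h => hdeg h.symm

theorem elongates_of_right_left (hη₀ : 0 ≤ η) (hη : η < Real.pi) (hd : 0 ≤ d) (hζ₀ : 0 ≤ ζ)
    (hζ : ζ < Real.pi) (hD : 4 ≤ ‖leftGap (-1) 1 η d ζ‖) : Elongates (-1) 1 η d ζ := by
  intro L hL
  refine threeArc_of_bend (s := 0) (η := η) (y := ζ) hd le_rfl hη₀ hη hζ₀ hζ.le
    (by congr 1; ring) ?_ hD (by linarith) (by simp; linarith)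
  simp only [cscEnd, neg_one_mul, neg_zero, cis_zero]
  push_cast
  ring

/-- The segment is bulged until the shorter arc `ζ` is used up, at length `η + ζ + d / sinc ζ`; from
then on the path ends with a left arc. -/
theorem elongates_of_right_right (hη : η < Real.pi) (hd : 0 ≤ d) (hζ₀ : 0 ≤ ζ)
    (hζη : ζ ≤ η) (hD : 4 ≤ ‖leftGap (-1) (-1) η d ζ‖) : Elongates (-1) (-1) η d ζ := by
  intro L hL
  have e : -1 * η + -1 * ζ = -(η + ζ) := by ring
  have hsc : 0 < Real.sinc ζ := sinc_pos hζ₀ (by linarith)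
  by_cases h : η + ζ + 0 + d / Real.sinc ζ ≤ L
  · refine threeArc_of_bend (s := ζ) (η := η) (y := 0) hd hζ₀ hζη hη le_rfl Real.pi_pos.le
      (by congr 1; ring) ?_ hD (by linarith) h
    have e2 : cis (-(η + ζ)) = cis (-η) * cis (-ζ) := by rw [← cis_add]; congr 1; ring
    simp only [cscEnd, neg_one_mul, ← neg_add, e2]
    push_cast
    ring
  · push Not at h
    refine threeArc_of_right_shrink (d := d) hζη hη hζ₀ ?_ (by rw [e]) ?_ (by linarith) ?_
    · refine hd.lt_of_ne ?_
      rintro rfl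
      simp at h
      linarith
    · simp only [cscEnd, neg_one_mul]
      push_cast
      ring
    · rw [← le_div_iff₀ hsc]
      linarith

theorem leftGap_left_left : leftGap 1 1 η d ζ = d * cis η := by
  simp only [leftGap, cscEnd, one_mul]
  push_cast
  ring

theorem elongates_of_left_left (hη₀ : 0 ≤ η) (hη : η < Real.pi) (hζ₀ : 0 ≤ ζ)
    (hd : 0 ≤ d) (hζ : ζ < Real.pi) (hD : 4 ≤ ‖leftGap 1 1 η d ζ‖) : Elongates 1 1 η d ζ := by
  intro L hL
  rw [leftGap_left_left, norm_mul, norm_cis, mul_one, Complex.norm_real,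
    Real.norm_of_nonneg hd] at hD
  refine threeArc_of_isosceles_le (δ₀ := 0) (X := η) (Y := ζ) (D := d) le_rfl Real.pi_pos
    (by linarith) hη.le (by linarith) (by linarith) (by linarith) (fun δ _ _ => ?_)
    (Or.inr (by linarith)) (by simp; linarith) (by congr 1; ring) ?_
  · linarith [Real.sin_le_one δ]
  · simp only [cscEnd, one_mul]
    push_cast
    ring

theorem elongates_of_four_le_leftGap (hε₁ : ε₁ = 1 ∨ ε₁ = -1) (hε₃ : ε₃ = 1 ∨ ε₃ = -1)
    (hη₀ : 0 ≤ η) (hη : η < Real.pi) (hd : 0 ≤ d) (hζ₀ : 0 ≤ ζ) (hζ : ζ < Real.pi)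
    (hD : 4 ≤ ‖leftGap ε₁ ε₃ η d ζ‖) : Elongates ε₁ ε₃ η d ζ := by
  rcases hε₁ with rfl | rfl <;> rcases hε₃ with rfl | rfl
  · exact elongates_of_left_left hη₀ hη hζ₀ hd hζ hD
  · rw [← elongates_swap_iff]
    rw [← norm_leftGap_swap] at hD
    exact elongates_of_right_left hζ₀ hζ hd hη₀ hη hD
  · exact elongates_of_right_left hη₀ hη hd hζ₀ hζ hD
  · rcases le_total ζ η with h | h
    · exact elongates_of_right_right hη hd hζ₀ h hD
    · rw [← elongates_swap_iff]
      rw [← norm_leftGap_swap] at hD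
      exact elongates_of_right_right hζ hd hη₀ h hD

theorem elongates_of_four_le_rightGap (hε₁ : ε₁ = 1 ∨ ε₁ = -1) (hε₃ : ε₃ = 1 ∨ ε₃ = -1)
    (hη₀ : 0 ≤ η) (hη : η < Real.pi) (hd : 0 ≤ d) (hζ₀ : 0 ≤ ζ) (hζ : ζ < Real.pi)
    (hD : 4 ≤ ‖rightGap ε₁ ε₃ η d ζ‖) : Elongates ε₁ ε₃ η d ζ := by
  rw [← elongates_neg_iff]
  rw [← norm_leftGap_neg] at hD
  refine elongates_of_four_le_leftGap ?_ ?_ hη₀ hη hd hζ₀ hζ hD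
  · rcases hε₁ with rfl | rfl <;> simp
  · rcases hε₃ with rfl | rfl <;> simp

/-- The vector between the left centres has the component `d + 2 sin η` along the segment. -/
theorem le_norm_leftGap_right_left (hη₀ : 0 ≤ η) (hη : η < Real.pi) :
    d ≤ ‖leftGap (-1) 1 η d ζ‖ := by
  have h : leftGap (-1) 1 η d ζ = (starRingEnd ℂ) (bend d 0 η) := by
    rw [conj_bend]
    simp only [leftGap, cscEnd, neg_one_mul, one_mul, add_zero]
    push_cast
    ring
  rw [h, RCLike.norm_conj]
  have hsin := Real.sin_nonneg_of_nonneg_of_le_pi hη₀ hη.le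
  have hre : (bend d 0 η * cis (-η)).re = d + 2 * Real.sin η := by
    have e : bend d 0 η * cis (-η) = d + 2 * Complex.I * (cis (-η) - 1) := by
      have h1 := cis_mul_cis_neg η
      rw [bend, add_zero]
      linear_combination (d - 2 * Complex.I) * h1
    rw [e]
    simp [cis_re, cis_im]
  have := Complex.re_le_norm (bend d 0 η * cis (-η))
  rw [norm_mul, norm_cis, mul_one, hre] at this
  linarith

theorem elongates_of_four_le (hε₁ : ε₁ = 1 ∨ ε₁ = -1) (hε₃ : ε₃ = 1 ∨ ε₃ = -1)
    (hη₀ : 0 ≤ η) (hη : η < Real.pi) (hd : 4 ≤ d) (hζ₀ : 0 ≤ ζ) (hζ : ζ < Real.pi) :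
    Elongates ε₁ ε₃ η d ζ := by
  have hd₀ : 0 ≤ d := by linarith
  have hLL : 4 ≤ ‖leftGap 1 1 η d ζ‖ := by
    rwa [leftGap_left_left, norm_mul, norm_cis, mul_one, Complex.norm_real, Real.norm_of_nonneg hd₀]
  have hRL := hd.trans (le_norm_leftGap_right_left (ζ := ζ) hη₀ hη)
  rcases hε₁ with rfl | rfl
  · rw [← elongates_neg_iff]
    rcases hε₃ with rfl | rfl
    · rw [elongates_neg_iff]
      exact elongates_of_left_left hη₀ hη hζ₀ hd₀ hζ hLL
    · rw [neg_neg]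
      exact elongates_of_right_left hη₀ hη hd₀ hζ₀ hζ hRL
  · rcases hε₃ with rfl | rfl
    · exact elongates_of_right_left hη₀ hη hd₀ hζ₀ hζ hRL
    · rw [elongates_neg_iff]
      exact elongates_of_left_left hη₀ hη hζ₀ hd₀ hζ hLL

theorem elongates_of_cases (hε₁ : ε₁ = 1 ∨ ε₁ = -1) (hε₃ : ε₃ = 1 ∨ ε₃ = -1)
    (hη₀ : 0 ≤ η) (hη : η < 2 * Real.pi) (hd : 0 ≤ d) (hζ₀ : 0 ≤ ζ) (hζ : ζ < 2 * Real.pi)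
    (hdeg : ε₁ = ε₃ → d = 0 → η + ζ < 2 * Real.pi)
    (h : Real.pi ≤ η ∨ Real.pi ≤ ζ ∨ 4 ≤ d ∨ 4 ≤ ‖rightGap ε₁ ε₃ η d ζ‖ ∨
      4 ≤ ‖leftGap ε₁ ε₃ η d ζ‖) : Elongates ε₁ ε₃ η d ζ := by
  by_cases h1 : Real.pi ≤ η
  · exact elongates_of_pi_le hε₁ hε₃ h1 hη hd hζ₀ hζ hdeg
  by_cases h2 : Real.pi ≤ ζ
  · rw [← elongates_swap_iff]
    exact elongates_of_pi_le hε₃ hε₁ h2 hζ hd hη₀ hη fun h h' => by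
      rw [add_comm]; exact hdeg h.symm h'
  push Not at h1 h2
  rcases h with h | h | h | h | h
  · linarith
  · linarith
  · exact elongates_of_four_le hε₁ hε₃ hη₀ h1 h hζ₀ h2
  · exact elongates_of_four_le_rightGap hε₁ hε₃ hη₀ h1 hd hζ₀ h2 h
  · exact elongates_of_four_le_leftGap hε₁ hε₃ hη₀ h1 hd hζ₀ h2 h

end

/-! ### Back to radius `rmin` -/

section

variable {rmin η d ζ ε₁ ε₃ : ℝ} {A B : OrientedPoint} {Λ : ℝ → ℂ}

theorem advance_csc (hr : 0 < rmin) (hε₁ : ε₁ = 1 ∨ ε₁ = -1) (hε₃ : ε₃ = 1 ∨ ε₃ = -1) :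
    ((Track.circle (ε₃ * rmin)).advance (Track.line.advance
      ((Track.circle (ε₁ * rmin)).advance A η) d) ζ).pos
        = A.pos + rmin * unitVec A.angle * cscEnd ε₁ ε₃ (η / rmin) (d / rmin) (ζ / rmin) ∧
    unitVec ((Track.circle (ε₃ * rmin)).advance (Track.line.advance
      ((Track.circle (ε₁ * rmin)).advance A η) d) ζ).angle
        = unitVec A.angle * cis (ε₁ * (η / rmin) + ε₃ * (ζ / rmin)) := by
  have aux : ∀ {ε : ℝ} (s : ℝ), (ε = 1 ∨ ε = -1) →
      ε * rmin ≠ 0 ∧ s = ε * rmin * (ε * (s / rmin)) := by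
    rintro ε s (rfl | rfl)
    · exact ⟨by simp [hr.ne'], by field_simp⟩
    · exact ⟨by simp [hr.ne'], by field_simp⟩
  obtain ⟨h1, h1'⟩ := aux η hε₁
  obtain ⟨h3, h3'⟩ := aux ζ hε₃
  have hd : (d : ℂ) = rmin * (d / rmin : ℝ) := by
    rw [← Complex.ofReal_mul, mul_div_cancel₀ _ hr.ne']
  rw [h1', h3', Track.advance_circle_mul h1, Track.advance_circle_mul h3, ← h1', ← h3']
  simp only [Track.advance, unitVec_add, cscEnd, cis_add, hd]
  constructor
  · push_cast
    ring
  · ring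

theorem IsConcat.end_eq_cscEnd (hr : 0 < rmin) (hε₁ : ε₁ = 1 ∨ ε₁ = -1) (hε₃ : ε₃ = 1 ∨ ε₃ = -1)
    (ht : IsTrajectory rmin A B (η + d + ζ) Λ)
    (hc : IsConcat rmin A (.circle (ε₁ * rmin)) .line (.circle (ε₃ * rmin)) η d ζ Λ) :
    B.pos = A.pos + rmin * unitVec A.angle * cscEnd ε₁ ε₃ (η / rmin) (d / rmin) (ζ / rmin) ∧
      unitVec B.angle = unitVec A.angle * cis (ε₁ * (η / rmin) + ε₃ * (ζ / rmin)) := by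
  obtain ⟨h1, h2⟩ := hc.end_eq hr ht
  obtain ⟨h1', h2'⟩ := advance_csc (A := A) (η := η) (d := d) (ζ := ζ) hr hε₁ hε₃
  exact ⟨h1.symm.trans h1', h2.symm.trans h2'⟩

/-- A full turn can be cut off from two consecutive arcs of the same circle. -/
theorem exists_trajectory_sub_two_pi (hr : 0 < rmin) (hε : ε₁ = 1 ∨ ε₁ = -1)
    (hη : η < 2 * Real.pi * rmin) (hζ : ζ < 2 * Real.pi * rmin)
    (hsum : 2 * Real.pi * rmin ≤ η + ζ)
    (hB : B.pos = A.pos + rmin * unitVec A.angle * cscEnd ε₁ ε₁ (η / rmin) 0 (ζ / rmin))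
    (hB' : unitVec B.angle = unitVec A.angle * cis (ε₁ * (η / rmin) + ε₁ * (ζ / rmin))) :
    ∃ Γ, IsTrajectory rmin A B (η + ζ - 2 * Real.pi * rmin) Γ := by
  have habs : |ε₁ * rmin| = rmin := by rcases hε with rfl | rfl <;> simp [abs_of_pos hr]
  have hcis : cis (ε₁ * ((η + ζ - 2 * Real.pi * rmin) / rmin))
      = cis (ε₁ * (η / rmin) + ε₁ * (ζ / rmin)) := by
    have e : (η + ζ - 2 * Real.pi * rmin) / rmin = η / rmin + ζ / rmin - 2 * Real.pi := by
      field_simp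
    rw [e]
    rcases hε with rfl | rfl
    · simp only [one_mul, cis_sub_two_pi]
    · rw [← cis_sub_two_pi]
      congr 1
      ring
  obtain ⟨h1, h2⟩ := advance_csc (A := A) (η := η + ζ - 2 * Real.pi * rmin) (d := 0) (ζ := 0)
    hr hε hε
  have h := isTrajectory_concatPath (A := A) (B := B) (γ₁ := .circle (ε₁ * rmin)) (γ₂ := .line)
    (γ₃ := .circle (ε₁ * rmin)) (s₁ := η + ζ - 2 * Real.pi * rmin) (s₂ := 0) (s₃ := 0) hr
    ⟨habs.ge, by linarith, by rw [habs]; linarith⟩ le_rfl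
    ⟨habs.ge, le_rfl, by rw [habs]; positivity⟩ ?_ ?_
  · rw [add_zero, add_zero] at h
    exact ⟨_, h⟩
  · rw [h1, hB]
    congr 2
    simp only [cscEnd, zero_div, mul_zero, add_zero, hcis]
    push_cast
    ring
  · rw [h2, hB', zero_div, mul_zero, add_zero, hcis]

theorem exists_shortestCSC_of_mem_setO (h : (A, B) ∈ setO rmin) :
    ∃ (η d ζ : ℝ) (Λ : ℝ → ℂ), IsShortestCSC rmin A B η d ζ Λ ∧
      (Real.pi * rmin ≤ η ∨ Real.pi * rmin ≤ ζ ∨ 4 * rmin ≤ d ∨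
        4 * rmin ≤ dist (A.rightCenter rmin) (B.rightCenter rmin) ∨
        4 * rmin ≤ dist (A.leftCenter rmin) (B.leftCenter rmin)) := by
  rcases h with (((⟨η, d, ζ, Λ, h, h'⟩ | ⟨η, d, ζ, Λ, h, h'⟩) | ⟨η, d, ζ, Λ, h, h'⟩) |
    ⟨η, d, ζ, Λ, h, h'⟩) | ⟨η, d, ζ, Λ, h, h'⟩ <;> exact ⟨η, d, ζ, Λ, h, by tauto⟩

end

end

theorem mainTheorem2 (rmin : ℝ) (hr : 0 < rmin) (A B : OrientedPoint)
    (hAB : (A, B) ∈ setO rmin)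
    (lm : ℝ) (Λm : ℝ → ℂ) (hm : IsDubinsShortestPath rmin A B lm Λm)
    (lo : ℝ) (hlo : lm ≤ lo) :
    ∃ Λ : ℝ → ℂ, IsTrajectory rmin A B lo Λ ∧ IsCircleCircleCircle rmin A lo Λ := by
  obtain ⟨η, d, ζ, Λ, ⟨⟨ht, hmin⟩, ε₁, ε₃, hε₁, hε₃, hc⟩, hcase⟩ :=
    exists_shortestCSC_of_mem_setO hAB
  -- The given shortest path and the one witnessing membership in `setO` may differ, but have equal
  -- lengths.
  obtain rfl : lm = η + d + ζ := le_antisymm (hm.2 _ _ ht) (hmin _ _ hm.1)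
  rcases hlo.eq_or_lt with rfl | hlo
  · exact ⟨Λ, ht, ε₁ * rmin, ε₃ * rmin, .line, η, d, ζ, by simp, by simp, rfl, hc⟩
  obtain ⟨hB, hB'⟩ := IsConcat.end_eq_cscEnd hr hε₁ hε₃ ht hc
  have habs : ∀ {ε : ℝ}, (ε = 1 ∨ ε = -1) → |ε * rmin| = rmin := by
    rintro ε (rfl | rfl) <;> simp [abs_of_pos hr]
  obtain ⟨⟨-, hη₀, hη⟩, hd, ⟨-, hζ₀, hζ⟩, -⟩ := hc
  rw [habs hε₁] at hη
  rw [habs hε₃] at hζ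
  have hd : 0 ≤ d := hd
  have hgap : ∀ g : ℂ, ‖(rmin : ℂ) * unitVec A.angle * g‖ = rmin * ‖g‖ := fun g => by
    rw [norm_mul, norm_mul, norm_unitVec, mul_one, Complex.norm_real, Real.norm_of_nonneg hr.le]
  have helong : Elongates ε₁ ε₃ (η / rmin) (d / rmin) (ζ / rmin) := by
    refine elongates_of_cases hε₁ hε₃ (by positivity) (by rwa [div_lt_iff₀ hr]) (by positivity)
      (by positivity) (by rwa [div_lt_iff₀ hr]) ?_ ?_
    · rintro rfl hd0
      rw [← add_div, div_lt_iff₀ hr]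
      -- Two arcs of one circle with total at least a full turn contradict minimality, since
      -- removing the turn leaves a shorter trajectory.
      by_contra! hsum
      rw [hd0] at hB
      obtain ⟨Γ, hΓ⟩ := exists_trajectory_sub_two_pi hr hε₁ hη hζ hsum hB hB'
      have := hmin _ _ hΓ
      have := mul_pos Real.pi_pos hr
      linarith
    · rcases hcase with h | h | h | h | h
      · exact Or.inl (by rwa [le_div_iff₀ hr])
      · exact Or.inr (Or.inl (by rwa [le_div_iff₀ hr]))
      · exact Or.inr (Or.inr (Or.inl (by rwa [le_div_iff₀ hr])))
      · refine Or.inr (Or.inr (Or.inr (Or.inl (le_of_mul_le_mul_left ?_ hr))))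
        rw [← hgap, mul_comm rmin]
        refine h.trans_eq ?_
        rw [dist_comm, dist_eq_norm]
        congr 1
        simp only [OrientedPoint.rightCenter, OrientedPoint.center, rightGap, hB, hB']
        push_cast
        ring
      · refine Or.inr (Or.inr (Or.inr (Or.inr (le_of_mul_le_mul_left ?_ hr))))
        rw [← hgap, mul_comm rmin]
        refine h.trans_eq ?_
        rw [dist_comm, dist_eq_norm]
        congr 1
        simp only [OrientedPoint.leftCenter, OrientedPoint.center, leftGap, hB, hB']
        ring
  have := (helong (lo / rmin) (by
    rw [← add_div, ← add_div]
    exact div_lt_div_of_pos_right hlo hr)).exists_trajectory hr hB hB'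
  rwa [mul_div_cancel₀ _ hr.ne'] at this
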